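/- **Setting.** Fix a time $t$. Let $(c_m,\delta_m)_{m\ge1}$ be i.i.d. pairs of real random variables and $(b_n,\omega_n,\theta_n)_{n\ge 1}$ i.i.d. triples of real random variables, the two families being independent of each other, with $\mathbb E[c_1^2]<\infty$ and $\mathbb E[b_1^2]<\infty$. Here $c_m$ and $\delta_m$ are the amplitude and the random phase error of the $m$-th column of a reconfigurable intelligent surface (RIS), and $b_n,\omega_n,\theta_n$ are the amplitude, Doppler frequency and phase of the $n$-th multipath component of the direct link. Let $\omega_0,\theta_0,\epsilon\in\mathbb R$ and $(\bar\phi_m)_{m\ge1}\subset\mathbb R$ be deterministic parameters ($\bar\phi_m$ is the nominal phase shift of column $m$, and $\phi_m=\bar\phi_m+\delta_m$ is the actual one). For $M$ columns and $N$ multipath components the in-phase and quadrature components are $$T_c=\sum_{m=1}^{M}c_m\cos(\omega_0t+\theta_0-\epsilon m+\phi_m)+\sum_{n=1}^{N}b_n\cos(\omega_nt+\theta_n),$$ $$T_s=\sum_{m=1}^{M}c_m\sin(\omega_0t+\theta_0-\epsilon m+\phi_m)+\sum_{n=1}^{N}b_n\sin(\omega_nt+\theta_n),$$ and $\tilde R=T_c+jT_s$.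 Put $$\Xi^2=\mathbb E[T_c]^2+\mathbb E[T_s]^2,\quad \sigma=\mathrm{Var}(T_c)+\mathrm{Var}(T_s),\quad \Omega=\Xi^2+\sigma,\quad K^{\mathrm{Eff}}=\frac{\Xi^2}{\sigma},\quad m^*=\frac{(\sigma+\Xi^2)^2}{(\sigma+\Xi^2)^2-\Xi^4}.$$ $\mathrm{Rice}(K,\Omega)$ is the law on $(0,\infty)$ with density $\frac{2x(K+1)}{\Omega}e^{-K-(K+1)x^2/\Omega}I_0\bigl(2x\sqrt{K(K+1)/\Omega}\bigr)$, where $I_0$ is the modified Bessel function of order zero, and $\mathrm{Nak}(m,\Omega)$ is the law on $(0,\infty)$ with density $\frac{2m^m}{\Gamma(m)\Omega^m}x^{2m-1}e^{-mx^2/\Omega}$. Call a choice of $M,N$ and of the deterministic parameters *balanced* if $\sigma>0$, $\mathrm{Var}(T_c)=\mathrm{Var}(T_s)$ and $\mathrm{Cov}(T_c,T_s)=0$. The Kolmogorov distance of two laws is the supremum of the absolute difference of their distribution functions. **Theorem.** 1. For every $\eta>0$ there are $n_0\in\mathbb N$ and $L>0$ such that for all $M,N\ge n_0$ and all deterministic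 parameters $\omega_0,\theta_0,\epsilon,(\bar\phi_m)$ for which the choice is balanced: (a) the Kolmogorov distance between the law of $|\tilde R|$ and $\mathrm{Rice}(K^{\mathrm{Eff}},\Omega)$ is at most $\eta$; (b) if $K^{\mathrm{Eff}}\le 1/L$ or $K^{\mathrm{Eff}}\ge L$, the Kolmogorov distance between the law of $|\tilde R|$ and $\mathrm{Nak}(m^*,\Omega)$ is at most $\eta$. 2. Let the deterministic parameters be fixed with $\bar\phi_m=\epsilon m$ for all $m$, so that the RIS terms are identically distributed. For every $\eta>0$ there is $n_0$ such that, for all $M=N\ge n_0$ for which the choice is balanced, the Kolmogorov distance between the law of $|\tilde R|$ and $\mathrm{Nak}(m^*,\Omega)$ is at most $\eta$. 3. For all $M,N$ and all deterministic parameters for which the choice is balanced, $\mathbb E[|\tilde R|^2]=\Omega$, $m^*>0$, and $\mathrm{Nak}(m^*,\Omega)$ is the Nakagami law equivalent to $\mathrm{Rice}(K^{\mathrm{Eff}},\Omega)$: for $m',\Omega'>0$, the laws $\mathrm{Nak}(m',\Omega')$ and $\mathrm{Rice}(K^{\mathrm{Eff}},\Omega)$ have the same second and the same fourth moments if and only if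 $m'=m^*$ and $\Omega'=\Omega$. -/

import Mathlib

open MeasureTheory ProbabilityTheory Set

noncomputable section

namespace RIS

/-- Modified Bessel function of the first kind of order zero,
`I₀(z) = (1/π) ∫₀^π exp (z cos u) du`. -/
def besselI0 (z : ℝ) : ℝ :=
  Real.pi⁻¹ * ∫ u in (0 : ℝ)..Real.pi, Real.exp (z * Real.cos u)

/-- Density on `x > 0` of the Rician law with shape factor `K` and scale factor (mean square) `Ωp`. -/
def ricianPDF (K Ωp x : ℝ) : ℝ :=
  2 * x * (K + 1) / Ωp * Real.exp (-K - (K + 1) * x ^ 2 / Ωp)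
    * besselI0 (2 * x * √(K * (K + 1) / Ωp))

/-- The Rician law; meaningful for `0 ≤ K` and `0 < Ωp`. -/
def ricianMeasure (K Ωp : ℝ) : Measure ℝ :=
  (volume.restrict (Ioi 0)).withDensity fun x ↦ ENNReal.ofReal (ricianPDF K Ωp x)

/-- Density on `x > 0` of the Nakagami law with shape `m` and mean square `Ωp`. -/
def nakagamiPDF (m Ωp x : ℝ) : ℝ :=
  2 * m ^ m / (Real.Gamma m * Ωp ^ m) * x ^ (2 * m - 1) * Real.exp (-m * x ^ 2 / Ωp)

/-- The Nakagami law; meaningful for `0 < m` and `0 < Ωp`. -/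
def nakagamiMeasure (m Ωp : ℝ) : Measure ℝ :=
  (volume.restrict (Ioi 0)).withDensity fun x ↦ ENNReal.ofReal (nakagamiPDF m Ωp x)

/-- The random quantities of the channel. Components are numbered from `0`. -/
structure Randomness (S : Type*) where
  /-- amplitude reflected by each RIS column -/
  c : ℕ → S → ℝ
  /-- random phase error of each RIS column (identically zero for an exact phase shift) -/
  δ : ℕ → S → ℝ
  /-- amplitude of each direct multipath component -/
  b : ℕ → S → ℝ
  /-- Doppler angular frequency of each direct multipath component -/
  ω : ℕ → S → ℝ
  /-- phase of each direct multipath component -/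
  θ : ℕ → S → ℝ

/-- The deterministic quantities: Doppler frequency `ω₀` and fixed phase `θ₀` of the RIS link, phase
increment `ε` between neighbouring columns, and the nominal phase shift `φ` of each column. The
phase shift that a column actually applies is its nominal one plus its phase error. -/
structure Config where
  ω₀ : ℝ
  θ₀ : ℝ
  ε : ℝ
  φ : ℕ → ℝ

variable {S : Type*} [MeasurableSpace S]

/-- The statistical model: the pairs (amplitude, phase error) of the RIS columns are i.i.d., the
triples (amplitude, Doppler frequency, phase) of the direct multipath components are i.i.d., the two
families are independent of each other, and the amplitudes are square integrable. -/
structure Randomness.IsIID (X : Randomness S) (μ : Measure S) : Prop where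
  identDistrib_ris : ∀ m, IdentDistrib (fun s ↦ (X.c m s, X.δ m s)) (fun s ↦ (X.c 0 s, X.δ 0 s)) μ μ
  iIndep_ris : iIndepFun (fun m s ↦ (X.c m s, X.δ m s)) μ
  identDistrib_direct : ∀ n, IdentDistrib (fun s ↦ (X.b n s, X.ω n s, X.θ n s))
    (fun s ↦ (X.b 0 s, X.ω 0 s, X.θ 0 s)) μ μ
  iIndep_direct : iIndepFun (fun n s ↦ (X.b n s, X.ω n s, X.θ n s)) μ
  indep : IndepFun (fun s m ↦ (X.c m s, X.δ m s)) (fun s n ↦ (X.b n s, X.ω n s, X.θ n s)) μ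
  memLp_c : MemLp (X.c 0) 2 μ
  memLp_b : MemLp (X.b 0) 2 μ

/-- In-phase component at time `t`, with `M` RIS columns and `N` direct multipath components. -/
def Tc (X : Randomness S) (g : Config) (t : ℝ) (M N : ℕ) (s : S) : ℝ :=
  ∑ m ∈ Finset.range M,
      X.c m s * Real.cos (g.ω₀ * t + g.θ₀ - g.ε * (m + 1) + (g.φ m + X.δ m s))
    + ∑ n ∈ Finset.range N, X.b n s * Real.cos (X.ω n s * t + X.θ n s)

/-- Quadrature component. -/
def Ts (X : Randomness S) (g : Config) (t : ℝ) (M N : ℕ) (s : S) : ℝ :=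
  ∑ m ∈ Finset.range M,
      X.c m s * Real.sin (g.ω₀ * t + g.θ₀ - g.ε * (m + 1) + (g.φ m + X.δ m s))
    + ∑ n ∈ Finset.range N, X.b n s * Real.sin (X.ω n s * t + X.θ n s)

/-- Complex envelope `T_c + j T_s`. -/
def complexEnvelope (X : Randomness S) (g : Config) (t : ℝ) (M N : ℕ) (s : S) : ℂ :=
  (Tc X g t M N s : ℂ) + Complex.I * (Ts X g t M N s : ℂ)

/-- `Ξ² = E[T_c]² + E[T_s]²`. -/
def XiSq (X : Randomness S) (μ : Measure S) (g : Config) (t : ℝ) (M N : ℕ) : ℝ :=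
  (∫ s, Tc X g t M N s ∂μ) ^ 2 + (∫ s, Ts X g t M N s ∂μ) ^ 2

/-- `σ = Var T_c + Var T_s`. -/
def sigma (X : Randomness S) (μ : Measure S) (g : Config) (t : ℝ) (M N : ℕ) : ℝ :=
  variance (Tc X g t M N) μ + variance (Ts X g t M N) μ

/-- Effective shape factor `Ξ² / σ`. -/
def KEff (X : Randomness S) (μ : Measure S) (g : Config) (t : ℝ) (M N : ℕ) : ℝ :=
  XiSq X μ g t M N / sigma X μ g t M N

/-- Scale factor `Ξ² + σ`. -/
def scale (X : Randomness S) (μ : Measure S) (g : Config) (t : ℝ) (M N : ℕ) : ℝ :=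
  XiSq X μ g t M N + sigma X μ g t M N

/-- Nakagami shape `(σ + Ξ²)² / ((σ + Ξ²)² - Ξ⁴)`. -/
def mNak (X : Randomness S) (μ : Measure S) (g : Config) (t : ℝ) (M N : ℕ) : ℝ :=
  (sigma X μ g t M N + XiSq X μ g t M N) ^ 2
    / ((sigma X μ g t M N + XiSq X μ g t M N) ^ 2 - XiSq X μ g t M N ^ 2)

/-- In-phase and quadrature components are not both degenerate, have equal variances, and are
uncorrelated. -/
def Balanced (X : Randomness S) (μ : Measure S) (g : Config) (t : ℝ) (M N : ℕ) : Prop :=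
  0 < sigma X μ g t M N ∧
  variance (Tc X g t M N) μ = variance (Ts X g t M N) μ ∧
  covariance (Tc X g t M N) (Ts X g t M N) μ = 0

/-- The distribution function of the envelope `|T_c + j T_s|` differs from that of `ν` by at most `η`
everywhere. -/
def EnvelopeWithin (X : Randomness S) (μ : Measure S) (g : Config) (t : ℝ) (M N : ℕ)
    (ν : Measure ℝ) (η : ℝ) : Prop :=
  ∀ x : ℝ, |μ.real {s | ‖complexEnvelope X g t M N s‖ ≤ x} - ν.real (Iic x)| ≤ η

end RIS

end

namespace RIS

open Filter Topology

/-- Weak convergence controls every measurable set up to a small thickening, uniformly. -/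
lemma eventually_forall_le_thickening {E ι : Type*} [PseudoMetricSpace E] [MeasurableSpace E]
    [BorelSpace E] [TopologicalSpace.SeparableSpace E] {l : Filter ι}
    {ν : ι → ProbabilityMeasure E} {ν₀ : ProbabilityMeasure E} (h : Tendsto ν l (𝓝 ν₀))
    {ε : ℝ} (hε : 0 < ε) :
    ∀ᶠ n in l, ∀ B, MeasurableSet B →
      (ν n : Measure E).real B ≤ (ν₀ : Measure E).real (Metric.thickening ε B) + ε ∧
      (ν₀ : Measure E).real B ≤ (ν n : Measure E).real (Metric.thickening ε B) + ε := by
  have h1 := (LevyProkhorov.continuous_ofMeasure_probabilityMeasure (Ω := E)).continuousAt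
    (x := ν₀) |>.tendsto.comp h
  have h2 : ∀ᶠ n in l, dist (LevyProkhorov.ofMeasure (ν n)) (LevyProkhorov.ofMeasure ν₀) < ε :=
    Metric.tendsto_nhds.1 h1 ε hε
  filter_upwards [h2] with n hn B hB
  rw [LevyProkhorov.dist_probabilityMeasure_def, levyProkhorovDist] at hn
  have hn' : levyProkhorovEDist (ν n : Measure E) (ν₀ : Measure E) < ENNReal.ofReal ε :=
    (ENNReal.lt_ofReal_iff_toReal_lt (levyProkhorovEDist_ne_top _ _)).2 hn
  have key : ∀ (ρ τ : Measure E) [IsProbabilityMeasure ρ] [IsProbabilityMeasure τ],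
      ρ B ≤ τ (Metric.thickening (ENNReal.ofReal ε).toReal B) + ENNReal.ofReal ε →
      ρ.real B ≤ τ.real (Metric.thickening ε B) + ε := by
    intro ρ τ _ _ h
    rw [ENNReal.toReal_ofReal hε.le] at h
    have := ENNReal.toReal_mono (by finiteness) h
    rwa [ENNReal.toReal_add (by finiteness) (by finiteness), ENNReal.toReal_ofReal hε.le] at this
  exact ⟨key _ _ (left_measure_le_of_levyProkhorovEDist_lt hn' hB),
    key _ _ (right_measure_le_of_levyProkhorovEDist_lt hn' hB)⟩

/-- If the limit law charges the shells `{r < f ≤ r + ε}` by at most `C * ε` for every `f` in a class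
of `1`-Lipschitz functions, then weak convergence is uniform over all sublevel sets of the class. -/
lemma eventually_forall_abs_sub_sublevel_le {E ι : Type*} [PseudoMetricSpace E]
    [MeasurableSpace E]
    [BorelSpace E] [TopologicalSpace.SeparableSpace E] {l : Filter ι}
    {ν : ι → ProbabilityMeasure E} {ν₀ : ProbabilityMeasure E} (h : Tendsto ν l (𝓝 ν₀))
    {F : Set (E → ℝ)} (hF : ∀ f ∈ F, LipschitzWith 1 f) {C : ℝ} (hC0 : 0 ≤ C)
    (hC : ∀ f ∈ F, ∀ r ε : ℝ, 0 ≤ ε →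
      (ν₀ : Measure E).real {x | f x ∈ Ioc r (r + ε)} ≤ C * ε)
    {η : ℝ} (hη : 0 < η) :
    ∀ᶠ n in l, ∀ f ∈ F, ∀ r : ℝ,
      |(ν n : Measure E).real {x | f x ≤ r} - (ν₀ : Measure E).real {x | f x ≤ r}| ≤ η := by
  have hε : 0 < η / (C + 1) := by positivity
  filter_upwards [eventually_forall_le_thickening h hε] with n hn f hf r
  set ε := η / (C + 1) with hεdef
  have hsum : C * ε + ε = η := by rw [hεdef]; field_simp
  have hmeas : ∀ r, MeasurableSet {x | f x ≤ r} := fun r ↦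
    (hF f hf).continuous.measurable measurableSet_Iic
  have hthick : ∀ r, Metric.thickening ε {x | f x ≤ r} ⊆ {x | f x ≤ r + ε} := by
    intro r x hx
    obtain ⟨z, hz, hxz⟩ := Metric.mem_thickening_iff.1 hx
    have := (hF f hf).dist_le_mul x z
    rw [Real.dist_eq] at this
    have h3 := le_abs_self (f x - f z)
    simp only [mem_ofPred_eq, NNReal.coe_one, one_mul] at hz this ⊢
    linarith
  have hshell : ∀ r, (ν₀ : Measure E).real {x | f x ≤ r + ε} ≤
      (ν₀ : Measure E).real {x | f x ≤ r} + C * ε := by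
    intro r
    have : {x | f x ≤ r + ε} ⊆ {x | f x ≤ r} ∪ {x | f x ∈ Ioc r (r + ε)} := by
      intro x hx
      rcases le_or_gt (f x) r with h | h
      · exact Or.inl h
      · exact Or.inr ⟨h, hx⟩
    calc _ ≤ _ := measureReal_mono this
      _ ≤ _ := measureReal_union_le _ _
      _ ≤ _ := by gcongr; exact hC f hf r ε hε.le
  have hup := (hn _ (hmeas r)).1
  have hlow := (hn _ (hmeas (r - ε))).2
  have h1 := measureReal_mono (μ := (ν₀ : Measure E)) (hthick r)
  have h2 := measureReal_mono (μ := (ν n : Measure E)) (hthick (r - ε))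
  have h3 := hshell r
  have h4 := hshell (r - ε)
  rw [sub_add_cancel] at h2 h4
  rw [abs_le]
  constructor <;> linarith

/-- Change of variables on the half-line for laws given by a density. -/
lemma map_withDensity_Ioi {φ φ' : ℝ → ℝ} (hm : Measurable φ)
    (hφ : ∀ x ∈ Ioi (0 : ℝ), HasDerivWithinAt φ (φ' x) (Ioi 0) x)
    (hinj : InjOn φ (Ioi 0)) (himg : φ '' Ioi 0 = Ioi 0) (g : ℝ → ENNReal) :
    ((volume.restrict (Ioi 0)).withDensity fun x ↦ ENNReal.ofReal |φ' x| * g (φ x)).map φ =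
      (volume.restrict (Ioi 0)).withDensity g := by
  ext s hs
  have hps : MeasurableSet (φ ⁻¹' s) := hm hs
  rw [Measure.map_apply hm hs, withDensity_apply _ hps, withDensity_apply _ hs,
    Measure.restrict_restrict hps, Measure.restrict_restrict hs]
  have himg' : s ∩ Ioi 0 = φ '' (φ ⁻¹' s ∩ Ioi 0) := by
    rw [inter_comm (φ ⁻¹' s), image_inter_preimage, himg, inter_comm]
  rw [himg', lintegral_image_eq_lintegral_abs_deriv_mul (hps.inter measurableSet_Ioi)
    (fun x hx ↦ (hφ x hx.2).mono inter_subset_right) (hinj.mono inter_subset_right)]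

/-- The standard circularly symmetric Gaussian law on `ℂ`. -/
noncomputable def complexGaussian : Measure ℂ :=
  volume.withDensity fun z ↦ ENNReal.ofReal (Real.pi⁻¹ * Real.exp (-‖z‖ ^ 2))

lemma measurable_complexGaussian_density :
    Measurable fun z : ℂ ↦ Real.pi⁻¹ * Real.exp (-‖z‖ ^ 2) := by fun_prop

lemma charFun_complexGaussian (ξ : ℂ) :
    charFun complexGaussian ξ = Complex.exp (-(‖ξ‖ ^ 2 / 4 : ℝ)) := by
  have hd : complexGaussian = volume.withDensity fun z ↦
      ((Real.toNNReal (Real.pi⁻¹ * Real.exp (-‖z‖ ^ 2)) : NNReal) : ENNReal) := rfl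
  rw [charFun_apply, hd, integral_withDensity_eq_integral_smul
    measurable_complexGaussian_density.real_toNNReal]
  have h := GaussianFourier.integral_cexp_neg_mul_sq_norm_add (b := 1) (by simp) Complex.I ξ
  have h2 : ∀ z : ℂ, (Real.toNNReal (Real.pi⁻¹ * Real.exp (-‖z‖ ^ 2))) •
      Complex.exp ((inner ℝ z ξ : ℝ) * Complex.I) =
      (Real.pi : ℂ)⁻¹ * Complex.exp (-1 * (‖z‖ : ℂ) ^ 2 + Complex.I * (inner ℝ ξ z : ℝ)) := by
    intro z
    rw [NNReal.smul_def, Real.coe_toNNReal _ (by positivity), Complex.exp_add,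
      real_inner_comm, Complex.real_smul]
    push_cast
    rw [mul_assoc, mul_comm Complex.I]
    simp
  simp_rw [h2]
  rw [integral_const_mul, h]
  simp only [Complex.finrank_real_complex, div_one]
  have : ((2 : ℕ) : ℂ) / 2 = 1 := by norm_num
  rw [this, Complex.cpow_one, ← mul_assoc, inv_mul_cancel₀ (by exact_mod_cast Real.pi_ne_zero),
    one_mul]
  congr 1
  push_cast
  rw [Complex.I_sq]
  ring

instance isFiniteMeasure_complexGaussian : IsFiniteMeasure complexGaussian := by
  have h := GaussianFourier.integral_rexp_neg_mul_sq_norm (V := ℂ) (b := 1) one_pos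
  have hi : Integrable fun z : ℂ ↦ Real.exp (-1 * ‖z‖ ^ 2) := by
    by_contra hc
    rw [integral_undef hc] at h
    have : (0 : ℝ) < (Real.pi / 1) ^ ((Module.finrank ℝ ℂ : ℝ) / 2) := by positivity
    exact this.ne h
  refine isFiniteMeasure_withDensity_ofReal ?_
  simpa using (hi.const_mul Real.pi⁻¹).2

instance isProbabilityMeasure_complexGaussian : IsProbabilityMeasure complexGaussian := by
  have h := charFun_complexGaussian 0
  rw [charFun_zero] at h
  have h' : complexGaussian.real univ = 1 := by
    simpa using h
  refine ⟨?_⟩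
  rw [measureReal_def] at h'
  rwa [ENNReal.toReal_eq_one_iff] at h'

lemma integral_exp_mul_cos_sub (z α : ℝ) :
    ∫ θ in Ioo (-Real.pi) Real.pi, Real.exp (z * Real.cos (θ - α)) =
      2 * Real.pi * besselI0 z := by
  rw [← integral_Ioc_eq_integral_Ioo, ← intervalIntegral.integral_of_le
    (by linarith [Real.pi_pos])]
  have hper : Function.Periodic (fun θ ↦ Real.exp (z * Real.cos θ)) (2 * Real.pi) := by
    intro θ; simp
  have hcont : Continuous fun θ ↦ Real.exp (z * Real.cos θ) := by fun_prop
  rw [intervalIntegral.integral_comp_sub_right (fun θ ↦ Real.exp (z * Real.cos θ)) α]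
  have h1 := hper.intervalIntegral_add_eq (-Real.pi - α) (-Real.pi)
  rw [show -Real.pi - α + 2 * Real.pi = Real.pi - α by ring,
    show -Real.pi + 2 * Real.pi = Real.pi by ring] at h1
  rw [h1, ← intervalIntegral.integral_add_adjacent_intervals
    (hcont.intervalIntegrable (-Real.pi) 0) (hcont.intervalIntegrable 0 Real.pi)]
  have h2 : ∫ θ in (-Real.pi)..0, Real.exp (z * Real.cos θ) =
      ∫ θ in (0 : ℝ)..Real.pi, Real.exp (z * Real.cos θ) := by
    have := intervalIntegral.integral_comp_neg (a := 0) (b := Real.pi)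
      (fun θ ↦ Real.exp (z * Real.cos θ))
    simp only [Real.cos_neg, neg_zero] at this
    exact this.symm
  rw [h2, besselI0]
  field_simp
  ring

lemma sq_norm_polar_sub (r θ : ℝ) (a : ℂ) :
    ‖(r : ℂ) * (Real.cos θ + Real.sin θ * Complex.I) - a‖ ^ 2 =
      r ^ 2 + ‖a‖ ^ 2 - 2 * r * ‖a‖ * Real.cos (θ - a.arg) := by
  have ha : a = ‖a‖ * (Real.cos a.arg + Real.sin a.arg * Complex.I) := by
    conv_lhs => rw [← Complex.norm_mul_cos_add_sin_mul_I a]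
    push_cast; rfl
  have hre : a.re = ‖a‖ * Real.cos a.arg := by
    conv_lhs => rw [ha]
    simp [-Complex.ofReal_cos, -Complex.ofReal_sin]
  have him : a.im = ‖a‖ * Real.sin a.arg := by
    conv_lhs => rw [ha]
    simp [-Complex.ofReal_cos, -Complex.ofReal_sin]
  rw [Complex.sq_norm, Complex.normSq_apply]
  simp only [Complex.sub_re, Complex.sub_im, Complex.mul_re, Complex.mul_im, Complex.ofReal_re,
    Complex.ofReal_im, Complex.add_re, Complex.add_im, Complex.I_re, Complex.I_im]
  rw [hre, him, Real.cos_sub]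
  have h1 := Real.sin_sq_add_cos_sq θ
  have h2 := Real.sin_sq_add_cos_sq a.arg
  linear_combination r ^ 2 * h1 + ‖a‖ ^ 2 * h2

lemma ricianPDF_add_one {K : ℝ} (hK : 0 ≤ K) (x : ℝ) :
    ricianPDF K (K + 1) x = 2 * x * Real.exp (-K - x ^ 2) * besselI0 (2 * x * √K) := by
  have hK1 : K + 1 ≠ 0 := by positivity
  rw [ricianPDF, mul_div_cancel_right₀ _ hK1, mul_div_cancel_left₀ _ hK1,
    mul_div_cancel_right₀ _ hK1]

lemma map_norm_add_complexGaussian (a : ℂ) :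
    complexGaussian.map (fun z ↦ ‖z + a‖) = ricianMeasure (‖a‖ ^ 2) (‖a‖ ^ 2 + 1) := by
  have hm : Measurable fun z : ℂ ↦ ‖z + a‖ := by fun_prop
  ext s hs
  rw [Measure.map_apply hm hs, complexGaussian, withDensity_apply _ (hm hs), ricianMeasure,
    withDensity_apply _ hs, ← lintegral_indicator (hm hs), ← lintegral_indicator hs]
  have h1 : ∀ z : ℂ, ((fun z : ℂ ↦ ‖z + a‖) ⁻¹' s).indicator
      (fun z : ℂ ↦ ENNReal.ofReal (Real.pi⁻¹ * Real.exp (-‖z‖ ^ 2))) z =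
      (fun w : ℂ ↦ s.indicator 1 ‖w‖ * ENNReal.ofReal (Real.pi⁻¹ * Real.exp (-‖w - a‖ ^ 2)))
        (z + a) := by
    intro z
    by_cases hz : ‖z + a‖ ∈ s
    · rw [indicator_of_mem (by exact hz)]
      simp [indicator_of_mem hz]
    · rw [indicator_of_notMem (by exact hz)]
      simp [indicator_of_notMem hz]
  simp_rw [h1]
  rw [lintegral_add_right_eq_self (μ := (volume : Measure ℂ)) (fun w : ℂ ↦ s.indicator 1 ‖w‖ *
    ENNReal.ofReal (Real.pi⁻¹ * Real.exp (-‖w - a‖ ^ 2))) a,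
    ← Complex.lintegral_comp_polarCoord_symm, polarCoord_target, Measure.volume_eq_prod,
    ← Measure.prod_restrict, lintegral_prod]
  swap
  · refine Measurable.aemeasurable ?_
    have hp : Measurable fun p : ℝ × ℝ ↦ (Complex.polarCoord.symm p : ℂ) := by
      simp only [Complex.polarCoord_symm_apply]; fun_prop
    have hi : Measurable (s.indicator (1 : ℝ → ENNReal)) := measurable_one.indicator hs
    refine Measurable.mul (by fun_prop) (Measurable.mul (hi.comp hp.norm) ?_)
    fun_prop
  refine setLIntegral_congr_fun measurableSet_Ioi fun r hr ↦ ?_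
  have hr0 : (0 : ℝ) < r := hr
  simp only [Complex.polarCoord_symm_apply, sq_norm_polar_sub, smul_eq_mul]
  have hnorm : ∀ θ : ℝ, ‖(r : ℂ) * (Real.cos θ + Real.sin θ * Complex.I)‖ = r := by
    intro θ
    have := Complex.norm_polarCoord_symm (r, θ)
    rwa [Complex.polarCoord_symm_apply, abs_of_pos hr0] at this
  simp only [hnorm]
  by_cases hrs : r ∈ s
  · rw [indicator_of_mem hrs, indicator_of_mem hrs]
    have h3 : ∀ θ : ℝ, ENNReal.ofReal r * ((1 : ℝ → ENNReal) r * ENNReal.ofReal (Real.pi⁻¹ *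
        Real.exp (-(r ^ 2 + ‖a‖ ^ 2 - 2 * r * ‖a‖ * Real.cos (θ - a.arg))))) =
        ENNReal.ofReal (r * Real.pi⁻¹ * Real.exp (-r ^ 2 - ‖a‖ ^ 2) *
          Real.exp (2 * r * ‖a‖ * Real.cos (θ - a.arg))) := by
      intro θ
      rw [Pi.one_apply, one_mul, ← ENNReal.ofReal_mul hr0.le, mul_assoc (r * Real.pi⁻¹),
        ← Real.exp_add, ← mul_assoc]
      congr 3
      ring
    simp_rw [h3]
    rw [← ofReal_integral_eq_lintegral_ofReal, integral_const_mul, integral_exp_mul_cos_sub]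
    · congr 1
      rw [ricianPDF_add_one (by positivity), Real.sqrt_sq (norm_nonneg _),
        show -r ^ 2 - ‖a‖ ^ 2 = -‖a‖ ^ 2 - r ^ 2 by ring]
      field_simp
    · exact (Continuous.integrableOn_Icc (by fun_prop)).mono_set Ioo_subset_Icc_self
    · exact Eventually.of_forall fun θ ↦ by positivity
  · simp [indicator_of_notMem hrs]

lemma ricianPDF_scale {K c : ℝ} (hK : 0 ≤ K) (hc : 0 < c) (x : ℝ) :
    c * ricianPDF K (c ^ 2 * (K + 1)) (c * x) = ricianPDF K (K + 1) x := by
  have hK1 : K + 1 ≠ 0 := by positivity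
  rw [ricianPDF_add_one hK, ricianPDF]
  have h1 : (K + 1) * (c * x) ^ 2 / (c ^ 2 * (K + 1)) = x ^ 2 := by field_simp
  have h2 : K * (K + 1) / (c ^ 2 * (K + 1)) = K / c ^ 2 := by field_simp
  rw [h1, h2, Real.sqrt_div hK, Real.sqrt_sq hc.le]
  have h3 : 2 * (c * x) * (√K / c) = 2 * x * √K := by field_simp
  rw [h3]
  field_simp

lemma map_mul_ricianMeasure {K c : ℝ} (hK : 0 ≤ K) (hc : 0 < c) :
    (ricianMeasure K (K + 1)).map (fun x ↦ c * x) = ricianMeasure K (c ^ 2 * (K + 1)) := by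
  have himg : (fun x ↦ c * x) '' Ioi 0 = Ioi 0 := by
    rw [image_mul_left_Ioi hc, mul_zero]
  have h := map_withDensity_Ioi (φ := fun x ↦ c * x) (φ' := fun _ ↦ c)
    (by fun_prop) (fun x _ ↦ by simpa using ((hasDerivAt_id x).const_mul c).hasDerivWithinAt)
    (fun x _ y _ h ↦ mul_left_cancel₀ hc.ne' h) himg
    fun x ↦ ENNReal.ofReal (ricianPDF K (c ^ 2 * (K + 1)) x)
  simp only [abs_of_pos hc, ← ENNReal.ofReal_mul hc.le, ricianPDF_scale hK hc] at h
  exact h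

/-- The envelope of a Gaussian of total variance `σ` around `b` is Rician. -/
lemma map_norm_sqrt_mul_add_complexGaussian {σ : ℝ} (hσ : 0 < σ) (b : ℂ) :
    complexGaussian.map (fun z ↦ ‖(√σ : ℂ) * z + b‖) =
      ricianMeasure (‖b‖ ^ 2 / σ) (‖b‖ ^ 2 + σ) := by
  have hs : 0 < √σ := Real.sqrt_pos.2 hσ
  have hs' : (√σ : ℂ) ≠ 0 := by exact_mod_cast hs.ne'
  have hK : ‖b / (√σ : ℂ)‖ ^ 2 = ‖b‖ ^ 2 / σ := by
    rw [norm_div, div_pow, Complex.norm_real, Real.norm_of_nonneg hs.le, Real.sq_sqrt hσ.le]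
  have h := map_mul_ricianMeasure (K := ‖b‖ ^ 2 / σ) (by positivity) hs
  rw [Real.sq_sqrt hσ.le, show σ * (‖b‖ ^ 2 / σ + 1) = ‖b‖ ^ 2 + σ by field_simp] at h
  rw [← h, ← hK, ← map_norm_add_complexGaussian, Measure.map_map (by fun_prop) (by fun_prop)]
  congr 1
  ext z
  simp only [Function.comp]
  have hn : ‖(√σ : ℂ)‖ = √σ := by rw [Complex.norm_real, Real.norm_of_nonneg hs.le]
  have hz : (√σ : ℂ) * z + b = √σ * (z + b / √σ) := by field_simp
  rw [hz, norm_mul, hn]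

lemma besselI0_le_exp {z : ℝ} (hz : 0 ≤ z) : besselI0 z ≤ Real.exp z := by
  have hpi := Real.pi_pos
  have : ∫ u in (0 : ℝ)..Real.pi, Real.exp (z * Real.cos u) ≤
      ∫ u in (0 : ℝ)..Real.pi, Real.exp z := by
    refine intervalIntegral.integral_mono_on hpi.le
      (Continuous.intervalIntegrable (by fun_prop) _ _) (by simp) fun u _ ↦ ?_
    exact Real.exp_le_exp.2 (mul_le_of_le_one_right hz (Real.cos_le_one u))
  rw [besselI0]
  calc _ ≤ Real.pi⁻¹ * ∫ u in (0 : ℝ)..Real.pi, Real.exp z := by gcongr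
    _ = _ := by simp

lemma besselI0_le_exp_mul_sqrt {z : ℝ} (hz : 0 < z) :
    besselI0 z ≤ Real.exp z * (√(Real.pi / (2 * z)) / 2) := by
  have hpi := Real.pi_pos
  have hb : 0 < 2 * z / Real.pi ^ 2 := by positivity
  have h1 : ∫ u in (0 : ℝ)..Real.pi, Real.exp (z * Real.cos u) ≤
      ∫ u in (0 : ℝ)..Real.pi, Real.exp z * Real.exp (-(2 * z / Real.pi ^ 2) * u ^ 2) := by
    refine intervalIntegral.integral_mono_on hpi.le
      (Continuous.intervalIntegrable (by fun_prop) _ _)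
      (Continuous.intervalIntegrable (by fun_prop) _ _) fun u hu ↦ ?_
    rw [← Real.exp_add]
    refine Real.exp_le_exp.2 ?_
    have := Real.cos_le_one_sub_mul_cos_sq (x := u) (by rw [abs_of_nonneg hu.1]; exact hu.2)
    calc z * Real.cos u ≤ z * (1 - 2 / Real.pi ^ 2 * u ^ 2) := by gcongr
      _ = _ := by ring
  have h2 : ∫ u in (0 : ℝ)..Real.pi, Real.exp (-(2 * z / Real.pi ^ 2) * u ^ 2) ≤
      Real.pi * (√(Real.pi / (2 * z)) / 2) := by
    rw [intervalIntegral.integral_of_le hpi.le]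
    calc _ ≤ ∫ u in Ioi (0 : ℝ), Real.exp (-(2 * z / Real.pi ^ 2) * u ^ 2) :=
          setIntegral_mono_set (integrable_exp_neg_mul_sq hb).integrableOn
            (Eventually.of_forall fun _ ↦ (Real.exp_pos _).le)
            Ioc_subset_Ioi_self.eventuallyLE
      _ = _ := by
        rw [integral_gaussian_Ioi, show Real.pi / (2 * z / Real.pi ^ 2) =
          Real.pi ^ 2 * (Real.pi / (2 * z)) by field_simp, Real.sqrt_mul (by positivity),
          Real.sqrt_sq hpi.le]
        ring
  rw [besselI0]
  calc _ ≤ Real.pi⁻¹ * (Real.exp z * (Real.pi * (√(Real.pi / (2 * z)) / 2))) := by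
        gcongr
        refine h1.trans ?_
        rw [intervalIntegral.integral_const_mul]
        gcongr
    _ = _ := by field_simp

lemma ricianPDF_le_two {K x : ℝ} (hK : 0 ≤ K) (hx : 0 ≤ x) : ricianPDF K (K + 1) x ≤ 2 := by
  rw [ricianPDF_add_one hK]
  rcases hx.eq_or_lt with rfl | hx
  · simp
  set k := √K with hk
  have hk0 : 0 ≤ k := Real.sqrt_nonneg _
  have hKk : K = k ^ 2 := (Real.sq_sqrt hK).symm
  rw [hKk]
  have hexp : Real.exp (-k ^ 2 - x ^ 2) * Real.exp (2 * x * k) = Real.exp (-(x - k) ^ 2) := by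
    rw [← Real.exp_add]; congr 1; ring
  have hle : Real.exp (-(x - k) ^ 2) ≤ 1 := Real.exp_le_one_iff.2 (by nlinarith [sq_nonneg (x - k)])
  rcases le_or_gt (x / 2) k with h | h
  · have hk1 : 0 < k := by linarith
    have hz : 0 < 2 * x * k := by positivity
    have hs : √(Real.pi / (2 * (2 * x * k))) / 2 ≤ 1 / x := by
      have : √(Real.pi / (2 * (2 * x * k))) ≤ 2 / x := by
        refine Real.sqrt_le_iff.2 ⟨by positivity, ?_⟩
        rw [div_pow, div_le_div_iff₀ (by positivity) (by positivity)]
        have h4 := Real.pi_le_four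
        have : x ^ 2 ≤ 2 * x * k := by nlinarith
        have : Real.pi * x ^ 2 ≤ 4 * (2 * x * k) := by gcongr
        linarith
      calc _ ≤ 2 / x / 2 := by gcongr
        _ = 1 / x := by ring
    calc 2 * x * Real.exp (-k ^ 2 - x ^ 2) * besselI0 (2 * x * k)
        ≤ 2 * x * Real.exp (-k ^ 2 - x ^ 2) * (Real.exp (2 * x * k) * (1 / x)) := by
          gcongr
          exact (besselI0_le_exp_mul_sqrt hz).trans (by gcongr)
      _ = 2 * (Real.exp (-k ^ 2 - x ^ 2) * Real.exp (2 * x * k)) := by field_simp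
      _ ≤ 2 * 1 := by rw [hexp]; gcongr
      _ = 2 := by ring
  · have h1 : x * Real.exp (-(x - k) ^ 2) ≤ 1 := by
      have h2 : Real.exp (-(x - k) ^ 2) ≤ Real.exp (-(x ^ 2 / 4)) :=
        Real.exp_le_exp.2 (by nlinarith)
      have h3 : x ≤ Real.exp (x ^ 2 / 4) := by
        have := Real.add_one_le_exp (x ^ 2 / 4)
        nlinarith [sq_nonneg (x / 2 - 1)]
      calc _ ≤ Real.exp (x ^ 2 / 4) * Real.exp (-(x ^ 2 / 4)) := by gcongr
        _ = 1 := by rw [← Real.exp_add]; simp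
    calc 2 * x * Real.exp (-k ^ 2 - x ^ 2) * besselI0 (2 * x * k)
        ≤ 2 * x * Real.exp (-k ^ 2 - x ^ 2) * Real.exp (2 * x * k) := by
          gcongr
          exact besselI0_le_exp (by positivity)
      _ = 2 * (x * Real.exp (-(x - k) ^ 2)) := by rw [← hexp]; ring
      _ ≤ 2 * 1 := by gcongr
      _ = 2 := by ring

lemma withDensity_real_Ioc_le {p : ℝ → ℝ} {C : ℝ} (hp : ∀ x ∈ Ioi (0 : ℝ), p x ≤ C)
    (hC : 0 ≤ C) (r : ℝ) {ε : ℝ} (hε : 0 ≤ ε) :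
    ((volume.restrict (Ioi 0)).withDensity fun x ↦ ENNReal.ofReal (p x)).real
      (Ioc r (r + ε)) ≤ C * ε := by
  rw [measureReal_def]
  refine ENNReal.toReal_le_of_le_ofReal (by positivity) ?_
  rw [withDensity_apply _ measurableSet_Ioc, Measure.restrict_restrict measurableSet_Ioc]
  calc _ ≤ ∫⁻ _ in Ioc r (r + ε) ∩ Ioi 0, ENNReal.ofReal C :=
        setLIntegral_mono measurable_const fun x hx ↦ ENNReal.ofReal_le_ofReal (hp x hx.2)
    _ ≤ ∫⁻ _ in Ioc r (r + ε), ENNReal.ofReal C := lintegral_mono_set inter_subset_left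
    _ = _ := by simp [ENNReal.ofReal_mul hC]

/-- The Gaussian law charges annuli of width `ε` by at most `2 * ε`, whatever their centre. -/
lemma complexGaussian_real_annulus_le (a : ℂ) (r : ℝ) {ε : ℝ} (hε : 0 ≤ ε) :
    complexGaussian.real {z | dist z a ∈ Ioc r (r + ε)} ≤ 2 * ε := by
  have h := map_norm_add_complexGaussian (-a)
  have h2 : complexGaussian.real {z | dist z a ∈ Ioc r (r + ε)} =
      (complexGaussian.map fun z ↦ ‖z + -a‖).real (Ioc r (r + ε)) := by
    rw [measureReal_def, measureReal_def, Measure.map_apply (by fun_prop) measurableSet_Ioc]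
    simp only [dist_eq_norm, sub_eq_add_neg]
    rfl
  rw [h2, h]
  exact withDensity_real_Ioc_le (fun x hx ↦ ricianPDF_le_two (by positivity) (le_of_lt hx))
    (by norm_num) r hε

lemma norm_cexp_mul_I_sub_taylor_le (x : ℝ) :
    ‖Complex.exp (x * Complex.I) - (1 + x * Complex.I - x ^ 2 / 2)‖ ≤ 4 * (x ^ 2 * min 1 |x|) := by
  rcases le_or_gt |x| 1 with h | h
  · have hn : ‖(x : ℂ) * Complex.I‖ = |x| := by simp
    have := Complex.exp_bound (x := x * Complex.I) (by rw [hn]; exact h) (n := 3) (by norm_num)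
    rw [hn] at this
    have hs : ∑ m ∈ Finset.range 3, (x * Complex.I) ^ m / (m.factorial : ℂ) =
        1 + x * Complex.I - x ^ 2 / 2 := by
      simp only [Finset.sum_range_succ, Finset.range_zero, Finset.sum_empty, mul_pow, Complex.I_sq,
        Nat.factorial]
      push_cast
      ring
    rw [hs] at this
    refine this.trans ?_
    have h3 : x ^ 2 * |x| = |x| ^ 3 := by rw [← sq_abs x]; ring
    rw [min_eq_right h, h3, mul_comm]
    gcongr
    norm_num [Nat.factorial]
  · rw [min_eq_left h.le, mul_one, ← sq_abs x]
    have hx : ‖(x : ℂ) * Complex.I‖ = |x| := by simp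
    have hx2 : ‖(x : ℂ) ^ 2 / 2‖ = |x| ^ 2 / 2 := by simp
    calc _ ≤ ‖Complex.exp (x * Complex.I)‖ + (‖(1 : ℂ)‖ + ‖(x : ℂ) * Complex.I‖ +
            ‖(x : ℂ) ^ 2 / 2‖) :=
          (norm_sub_le _ _).trans (by
            gcongr
            exact (norm_sub_le _ _).trans (by gcongr; exact norm_add_le _ _))
      _ = 1 + (1 + |x| + |x| ^ 2 / 2) := by
          rw [Complex.norm_exp_ofReal_mul_I, hx, hx2, norm_one]
      _ ≤ _ := by nlinarith

lemma abs_exp_neg_sub_one_sub_le {q : ℝ} (hq : 0 ≤ q) : |Real.exp (-q) - (1 - q)| ≤ q ^ 2 := by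
  rcases le_or_gt q 1 with h | h
  · have := Real.abs_exp_sub_one_sub_id_le (x := -q) (by rwa [abs_neg, abs_of_nonneg hq])
    rw [neg_sq] at this
    convert this using 2
    ring
  · have h1 := Real.exp_le_one_iff.2 (neg_nonpos.2 hq)
    have h2 := Real.add_one_le_exp (-q)
    rw [abs_of_nonneg (by linarith)]
    nlinarith

/-- Second-order expansion of a characteristic function against the Gaussian one. -/
lemma norm_integral_cexp_sub_exp_variance_le {S : Type*} [MeasurableSpace S] {μ : Measure S}
    [IsProbabilityMeasure μ] {X : S → ℝ} (hX : MemLp X 2 μ) (h0 : ∫ s, X s ∂μ = 0) :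
    ‖∫ s, Complex.exp (X s * Complex.I) ∂μ - Complex.exp (-(variance X μ / 2 : ℝ))‖ ≤
      4 * ∫ s, X s ^ 2 * min 1 |X s| ∂μ + variance X μ ^ 2 := by
  have hXm := hX.aestronglyMeasurable.aemeasurable
  have hi1 : Integrable X μ := hX.integrable (by norm_num)
  have hi2 : Integrable (fun s ↦ X s ^ 2) μ := hX.integrable_sq
  have hie : Integrable (fun s ↦ Complex.exp (X s * Complex.I)) μ := by
    refine Integrable.of_bound (C := 1) (by fun_prop) (Eventually.of_forall fun s ↦ ?_)
    rw [Complex.norm_exp_ofReal_mul_I]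
  have hi1c : Integrable (fun s ↦ (X s : ℂ) * Complex.I) μ := hi1.ofReal.mul_const _
  have hi2c : Integrable (fun s ↦ (X s : ℂ) ^ 2 / 2) μ := by
    have := (hi2.ofReal (𝕜 := ℂ)).div_const 2
    simpa using this
  have hv : variance X μ = ∫ s, X s ^ 2 ∂μ := variance_of_integral_eq_zero hXm h0
  have hmin : Integrable (fun s ↦ X s ^ 2 * min 1 |X s|) μ := by
    refine hi2.mono (by fun_prop) (Eventually.of_forall fun s ↦ ?_)
    rw [Real.norm_of_nonneg (by positivity), Real.norm_of_nonneg (by positivity)]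
    exact mul_le_of_le_one_right (by positivity) (min_le_left _ _)
  have hi01 : Integrable (fun s ↦ 1 + (X s : ℂ) * Complex.I) μ := (integrable_const _).add hi1c
  have h1 : ∫ s, (1 + (X s : ℂ) * Complex.I - (X s : ℂ) ^ 2 / 2) ∂μ =
      ((1 - variance X μ / 2 : ℝ) : ℂ) := by
    rw [integral_sub hi01 hi2c, integral_add (integrable_const _) hi1c,
      integral_mul_const, integral_div, integral_complex_ofReal, h0, hv]
    have : ∫ s, (X s : ℂ) ^ 2 ∂μ = ((∫ s, X s ^ 2 ∂μ : ℝ) : ℂ) := by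
      rw [← integral_complex_ofReal]; simp
    rw [this]
    simp
  have hA : ‖∫ s, Complex.exp (X s * Complex.I) ∂μ - ((1 - variance X μ / 2 : ℝ) : ℂ)‖ ≤
      4 * ∫ s, X s ^ 2 * min 1 |X s| ∂μ := by
    have hi02 : Integrable (fun s ↦ 1 + (X s : ℂ) * Complex.I - (X s : ℂ) ^ 2 / 2) μ :=
      hi01.sub hi2c
    rw [← h1, ← integral_sub hie hi02, ← integral_const_mul]
    exact norm_integral_le_of_norm_le (hmin.const_mul 4)
      (Eventually.of_forall fun s ↦ norm_cexp_mul_I_sub_taylor_le (X s))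
  have hvn := variance_nonneg X μ
  have hB : ‖((1 - variance X μ / 2 : ℝ) : ℂ) - Complex.exp (-(variance X μ / 2 : ℝ))‖ ≤
      variance X μ ^ 2 := by
    rw [← Complex.ofReal_neg, ← Complex.ofReal_exp, ← Complex.ofReal_sub, Complex.norm_real,
      Real.norm_eq_abs, abs_sub_comm]
    refine (abs_exp_neg_sub_one_sub_le (q := variance X μ / 2) (by positivity)).trans ?_
    nlinarith
  calc _ ≤ _ := norm_sub_le_norm_sub_add_norm_sub _ ((1 - variance X μ / 2 : ℝ) : ℂ) _
    _ ≤ _ := add_le_add hA hB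

lemma norm_mul_sub_mul_le {a b c d : ℂ} (ha : ‖a‖ ≤ 1) (hd : ‖d‖ ≤ 1) :
    ‖a * b - c * d‖ ≤ ‖a - c‖ + ‖b - d‖ := by
  have : a * b - c * d = a * (b - d) + (a - c) * d := by ring
  rw [this]
  calc _ ≤ ‖a‖ * ‖b - d‖ + ‖a - c‖ * ‖d‖ := by
        rw [← norm_mul, ← norm_mul]; exact norm_add_le _ _
    _ ≤ 1 * ‖b - d‖ + ‖a - c‖ * 1 := by gcongr
    _ = _ := by ring

lemma norm_prod_sub_prod_le_sum {ι : Type*} (s : Finset ι) (f g : ι → ℂ)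
    (hf : ∀ i, ‖f i‖ ≤ 1) (hg : ∀ i, ‖g i‖ ≤ 1) :
    ‖∏ i ∈ s, f i - ∏ i ∈ s, g i‖ ≤ ∑ i ∈ s, ‖f i - g i‖ := by
  classical
  induction s using Finset.induction_on with
  | empty => simp
  | insert i s hi ih =>
    rw [Finset.prod_insert hi, Finset.prod_insert hi, Finset.sum_insert hi]
    refine (norm_mul_sub_mul_le (hf i) ?_).trans (by gcongr)
    rw [norm_prod]
    exact Finset.prod_le_one (fun _ _ ↦ norm_nonneg _) fun j _ ↦ hg j

/-- Truncated second moment of a complex random variable around its mean, the quantity in the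
Lindeberg condition. -/
noncomputable def truncMoment {S : Type*} [MeasurableSpace S] (μ : Measure S) (Z : S → ℂ)
    (r : ℝ) : ℝ :=
  ∫ s, ‖Z s - ∫ s, Z s ∂μ‖ ^ 2 * min 1 (r * ‖Z s - ∫ s, Z s ∂μ‖) ∂μ

/-- Total variance of a complex random variable. -/
noncomputable def cvar {S : Type*} [MeasurableSpace S] (μ : Measure S) (Z : S → ℂ) : ℝ :=
  ∫ s, ‖Z s - ∫ s, Z s ∂μ‖ ^ 2 ∂μ

section Basic

variable {S : Type*} [MeasurableSpace S] {μ : Measure S} {Z : S → ℂ}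

lemma cvar_nonneg : 0 ≤ cvar μ Z := integral_nonneg fun _ ↦ by positivity

variable [IsProbabilityMeasure μ]

lemma integrable_sq_norm_sub (hZ : MemLp Z 2 μ) (c : ℂ) :
    Integrable (fun s ↦ ‖Z s - c‖ ^ 2) μ :=
  (hZ.sub (memLp_const c)).norm.integrable_sq

lemma truncMoment_eq_zero (hZ : MemLp Z 2 μ) (h : cvar μ Z = 0) (r : ℝ) :
    truncMoment μ Z r = 0 := by
  rw [cvar, integral_eq_zero_iff_of_nonneg (fun _ ↦ by positivity)
    (integrable_sq_norm_sub hZ _)] at h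
  rw [truncMoment]
  refine integral_eq_zero_of_ae ?_
  filter_upwards [h] with s hs
  simp only [Pi.zero_apply] at hs ⊢
  rw [hs, zero_mul]

lemma tendsto_truncMoment (hZ : MemLp Z 2 μ) :
    Tendsto (truncMoment μ Z) (𝓝[≥] 0) (𝓝 0) := by
  have hm := hZ.aestronglyMeasurable.aemeasurable
  have : (0 : ℝ) = ∫ s, ‖Z s - ∫ s, Z s ∂μ‖ ^ 2 * min 1 (0 * ‖Z s - ∫ s, Z s ∂μ‖) ∂μ := by
    simp
  conv => rhs; rw [this]
  refine tendsto_integral_filter_of_dominated_convergence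
    (fun s ↦ ‖Z s - ∫ s, Z s ∂μ‖ ^ 2) ?_ ?_ (integrable_sq_norm_sub hZ _) ?_
  · exact Eventually.of_forall fun r ↦ AEMeasurable.aestronglyMeasurable (by fun_prop)
  · filter_upwards [self_mem_nhdsWithin] with r hr
    refine Eventually.of_forall fun s ↦ ?_
    have hr' : (0 : ℝ) ≤ r := hr
    rw [Real.norm_of_nonneg (by positivity)]
    exact mul_le_of_le_one_right (by positivity) (min_le_left _ _)
  · refine Eventually.of_forall fun s ↦ ?_
    have : Continuous fun r : ℝ ↦
        ‖Z s - ∫ s, Z s ∂μ‖ ^ 2 * min 1 (r * ‖Z s - ∫ s, Z s ∂μ‖) := by fun_prop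
    exact (this.tendsto 0).mono_left nhdsWithin_le_nhds

end Basic

/-- Characteristic function of a centred sum of rotated i.i.d. complex random variables. -/
lemma norm_charFun_rotated_sum_sub_le {S : Type*} [MeasurableSpace S] {μ : Measure S}
    [IsProbabilityMeasure μ] {ζ : ℕ → S → ℂ} (hind : iIndepFun ζ μ)
    (hid : ∀ m, IdentDistrib (ζ m) (ζ 0) μ μ) (hL : MemLp (ζ 0) 2 μ) {u : ℕ → ℂ}
    (hu : ∀ m, ‖u m‖ = 1) (M : ℕ) (ξ : ℂ) :
    ‖charFun (μ.map fun s ↦ ∑ m ∈ Finset.range M, u m * (ζ m s - ∫ s, ζ 0 s ∂μ)) ξ -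
        Complex.exp (-((∑ m ∈ Finset.range M,
          variance (fun s ↦ inner ℝ (u m * ζ m s) ξ) μ) / 2 : ℝ))‖ ≤
      M * ‖ξ‖ ^ 2 * (4 * truncMoment μ (ζ 0) ‖ξ‖ + ‖ξ‖ ^ 2 * cvar μ (ζ 0) ^ 2) := by
  set e := ∫ s, ζ 0 s ∂μ with he
  have hm : ∀ m, AEMeasurable (ζ m) μ := fun m ↦ (hid m).aemeasurable_fst
  have hLm : ∀ m, MemLp (ζ m) 2 μ := fun m ↦ (hid m).symm.memLp_snd hL
  have hem : ∀ m, ∫ s, ζ m s ∂μ = e := fun m ↦ (hid m).integral_eq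
  have hLc : ∀ m, MemLp (fun s ↦ u m * (ζ m s - e)) 2 μ := fun m ↦
    ((hLm m).sub (memLp_const e)).const_mul (u m)
  have hLr : ∀ m, MemLp (fun s ↦ inner ℝ (u m * (ζ m s - e)) ξ) 2 μ := fun m ↦ by
    refine (hLc m).norm.of_le_mul (c := ‖ξ‖) (by have := hm m; fun_prop) ?_
    refine Eventually.of_forall fun s ↦ ?_
    rw [norm_norm, mul_comm ‖ξ‖]
    exact norm_inner_le_norm (𝕜 := ℝ) (u m * (ζ m s - e)) ξ
  have hnorm : ∀ m s, |inner ℝ (u m * (ζ m s - e)) ξ| ≤ ‖ξ‖ * ‖ζ m s - e‖ := fun m s ↦ by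
    have := abs_real_inner_le_norm (u m * (ζ m s - e)) ξ
    rwa [norm_mul, hu, one_mul, mul_comm ‖ζ m s - e‖] at this
  have hcent : ∀ m, ∫ s, inner ℝ (u m * (ζ m s - e)) ξ ∂μ = 0 := fun m ↦ by
    have h1 : ∀ s, inner ℝ (u m * (ζ m s - e)) ξ = inner ℝ ξ (u m * (ζ m s - e)) :=
      fun s ↦ real_inner_comm _ _
    simp_rw [h1]
    rw [integral_inner ((hLc m).integrable (by norm_num)), integral_const_mul,
      integral_sub ((hLm m).integrable (by norm_num)) (integrable_const _), hem]
    simp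
  have hvar : ∀ m, variance (fun s ↦ inner ℝ (u m * ζ m s) ξ) μ =
      variance (fun s ↦ inner ℝ (u m * (ζ m s - e)) ξ) μ := fun m ↦ by
    have h1 : (fun s ↦ inner ℝ (u m * (ζ m s - e)) ξ) =
        fun s ↦ inner ℝ (u m * ζ m s) ξ - inner ℝ (u m * e) ξ := by
      ext s; rw [mul_sub, inner_sub_left]
    rw [h1, variance_sub_const]
    have := hm m
    fun_prop
  have hind' : iIndepFun (fun m s ↦ u m * (ζ m s - e)) μ :=
    hind.comp (fun m z ↦ u m * (z - e)) fun m ↦ by fun_prop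
  rw [iIndepFun.charFun_map_fun_finsetSum_eq_prod (X := fun m s ↦ u m * (ζ m s - e))
    (fun m _ ↦ (hLc m).aestronglyMeasurable.aemeasurable) (hind'.restrict _)]
  have hexp : Complex.exp (-((∑ m ∈ Finset.range M,
      variance (fun s ↦ inner ℝ (u m * ζ m s) ξ) μ) / 2 : ℝ)) =
      ∏ m ∈ Finset.range M, Complex.exp (-(variance (fun s ↦ inner ℝ (u m * (ζ m s - e)) ξ) μ / 2 :
        ℝ)) := by
    rw [← Complex.exp_sum, Finset.sum_div]
    simp_rw [hvar]
    push_cast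
    rw [Finset.sum_neg_distrib]
  rw [hexp, Finset.prod_apply]
  have hprob : ∀ m, IsProbabilityMeasure (μ.map fun s ↦ u m * (ζ m s - e)) := fun m ↦
    Measure.isProbabilityMeasure_map (hLc m).aestronglyMeasurable.aemeasurable
  refine (norm_prod_sub_prod_le_sum _ _ _ (fun m ↦ norm_charFun_le_one _) fun m ↦ ?_).trans ?_
  · rw [← Complex.ofReal_neg, Complex.norm_exp_ofReal]
    exact Real.exp_le_one_iff.2 (neg_nonpos.2 (div_nonneg (variance_nonneg _ _) zero_le_two))
  have hterm : ∀ m, ‖charFun (μ.map fun s ↦ u m * (ζ m s - e)) ξ -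
      Complex.exp (-(variance (fun s ↦ inner ℝ (u m * (ζ m s - e)) ξ) μ / 2 : ℝ))‖ ≤
      ‖ξ‖ ^ 2 * (4 * truncMoment μ (ζ 0) ‖ξ‖ + ‖ξ‖ ^ 2 * cvar μ (ζ 0) ^ 2) := by
    intro m
    have hidc : IdentDistrib (fun s ↦ ‖ζ m s - e‖) (fun s ↦ ‖ζ 0 s - e‖) μ μ :=
      (hid m).comp (u := fun z ↦ ‖z - e‖) (by fun_prop)
    have hT : truncMoment μ (ζ 0) ‖ξ‖ =
        ∫ s, ‖ζ m s - e‖ ^ 2 * min 1 (‖ξ‖ * ‖ζ m s - e‖) ∂μ := by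
      rw [truncMoment, ← he]
      exact ((hidc.comp (u := fun x ↦ x ^ 2 * min 1 (‖ξ‖ * x)) (by fun_prop)).integral_eq).symm
    have hV : cvar μ (ζ 0) = ∫ s, ‖ζ m s - e‖ ^ 2 ∂μ := by
      rw [cvar, ← he]
      exact ((hidc.comp (u := fun x ↦ x ^ 2) (by fun_prop)).integral_eq).symm
    have hint : Integrable (fun s ↦ ‖ζ m s - e‖ ^ 2) μ := integrable_sq_norm_sub (hLm m) e
    have hint' : Integrable (fun s ↦ ‖ζ m s - e‖ ^ 2 * min 1 (‖ξ‖ * ‖ζ m s - e‖)) μ := by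
      refine hint.mono (by have := hm m; fun_prop) (Eventually.of_forall fun s ↦ ?_)
      rw [Real.norm_of_nonneg (by positivity), Real.norm_of_nonneg (by positivity)]
      exact mul_le_of_le_one_right (by positivity) (min_le_left _ _)
    rw [charFun_apply, integral_map (hLc m).aestronglyMeasurable.aemeasurable (by fun_prop)]
    refine (norm_integral_cexp_sub_exp_variance_le (hLr m) (hcent m)).trans ?_
    have hsq : ∀ s, inner ℝ (u m * (ζ m s - e)) ξ ^ 2 ≤ ‖ξ‖ ^ 2 * ‖ζ m s - e‖ ^ 2 := fun s ↦ by
      rw [← mul_pow, ← sq_abs]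
      gcongr
      exact hnorm m s
    have h1 : ∫ s, inner ℝ (u m * (ζ m s - e)) ξ ^ 2 *
        min 1 |inner ℝ (u m * (ζ m s - e)) ξ| ∂μ ≤ ‖ξ‖ ^ 2 * truncMoment μ (ζ 0) ‖ξ‖ := by
      rw [hT, ← integral_const_mul]
      refine integral_mono_of_nonneg (Eventually.of_forall fun s ↦ by positivity)
        (hint'.const_mul _) (Eventually.of_forall fun s ↦ ?_)
      beta_reduce
      rw [← mul_assoc]
      exact mul_le_mul (hsq s) (min_le_min le_rfl (hnorm m s)) (by positivity) (by positivity)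
    have h2 : variance (fun s ↦ inner ℝ (u m * (ζ m s - e)) ξ) μ ≤ ‖ξ‖ ^ 2 * cvar μ (ζ 0) := by
      rw [variance_of_integral_eq_zero (hLr m).aestronglyMeasurable.aemeasurable (hcent m), hV,
        ← integral_const_mul]
      exact integral_mono_of_nonneg (Eventually.of_forall fun s ↦ by positivity)
        (hint.const_mul _) (Eventually.of_forall hsq)
    have h3 := variance_nonneg (fun s ↦ inner ℝ (u m * (ζ m s - e)) ξ) μ
    calc _ ≤ 4 * (‖ξ‖ ^ 2 * truncMoment μ (ζ 0) ‖ξ‖) + (‖ξ‖ ^ 2 * cvar μ (ζ 0)) ^ 2 := by gcongr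
      _ = _ := by ring
  calc _ ≤ ∑ m ∈ Finset.range M, ‖ξ‖ ^ 2 * (4 * truncMoment μ (ζ 0) ‖ξ‖ +
        ‖ξ‖ ^ 2 * cvar μ (ζ 0) ^ 2) := Finset.sum_le_sum fun m _ ↦ hterm m
    _ = _ := by rw [Finset.sum_const, Finset.card_range, nsmul_eq_mul, mul_assoc]

section Group

variable {S : Type*} [MeasurableSpace S] {μ : Measure S}

lemma memLp_inner {Z : S → ℂ} (hZ : MemLp Z 2 μ) (ξ : ℂ) :
    MemLp (fun s ↦ inner ℝ (Z s) ξ) 2 μ := by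
  refine hZ.norm.of_le_mul (c := ‖ξ‖) (by have := hZ.aestronglyMeasurable.aemeasurable; fun_prop) ?_
  refine Eventually.of_forall fun s ↦ ?_
  rw [norm_norm, mul_comm ‖ξ‖]
  exact norm_inner_le_norm (𝕜 := ℝ) (Z s) ξ

lemma inner_one_right (z : ℂ) : inner ℝ z 1 = z.re := by simp [Complex.inner]

lemma inner_I_right (z : ℂ) : inner ℝ z Complex.I = z.im := by simp [Complex.inner]

lemma cvar_const_mul {Z : S → ℂ} {u : ℂ} (hu : ‖u‖ = 1) :
    cvar μ (fun s ↦ u * Z s) = cvar μ Z := by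
  simp only [cvar, integral_const_mul, ← mul_sub, norm_mul, hu, one_mul]

lemma cvar_eq_of_identDistrib {Z Z' : S → ℂ} (h : IdentDistrib Z Z' μ μ) :
    cvar μ Z = cvar μ Z' := by
  rw [cvar, cvar, h.integral_eq]
  exact (h.comp (u := fun z ↦ ‖z - ∫ s, Z' s ∂μ‖ ^ 2) (by fun_prop)).integral_eq

/-- The Lindeberg error of the sum of `M` copies of `Z`, relative to the total variance. -/
noncomputable def lindebergError (μ : Measure S) (Z : S → ℂ) (r : ℝ) : ℝ :=
  (4 * truncMoment μ Z r + r ^ 2 * cvar μ Z ^ 2) / cvar μ Z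

lemma truncMoment_nonneg (Z : S → ℂ) {r : ℝ} (hr : 0 ≤ r) : 0 ≤ truncMoment μ Z r :=
  integral_nonneg fun _ ↦ by positivity

/-- Sum of rotated complex random variables. -/
def rotSum (u : ℕ → ℂ) (ζ : ℕ → S → ℂ) (M : ℕ) (s : S) : ℂ :=
  ∑ m ∈ Finset.range M, u m * ζ m s

lemma variance_inner_add {Z Z' : S → ℂ} (hZ : MemLp Z 2 μ) (hZ' : MemLp Z' 2 μ)
    (h : IndepFun Z Z' μ) (ξ : ℂ) :
    variance (fun s ↦ inner ℝ (Z s + Z' s) ξ) μ =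
      variance (fun s ↦ inner ℝ (Z s) ξ) μ + variance (fun s ↦ inner ℝ (Z' s) ξ) μ := by
  simp_rw [inner_add_left]
  exact IndepFun.variance_fun_add (memLp_inner hZ ξ) (memLp_inner hZ' ξ)
    (h.comp (φ := fun z ↦ inner ℝ z ξ) (ψ := fun z ↦ inner ℝ z ξ) (by fun_prop) (by fun_prop))

variable {ζ : ℕ → S → ℂ} {u : ℕ → ℂ}

lemma memLp_rotSum (hL : ∀ m, MemLp (ζ m) 2 μ) (M : ℕ) : MemLp (rotSum u ζ M) 2 μ :=
  memLp_finsetSum _ fun m _ ↦ (hL m).const_mul (u m)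

lemma variance_inner_rotSum (hind : iIndepFun ζ μ) (hL : ∀ m, MemLp (ζ m) 2 μ) (M : ℕ) (ξ : ℂ) :
    variance (fun s ↦ inner ℝ (rotSum u ζ M s) ξ) μ =
      ∑ m ∈ Finset.range M, variance (fun s ↦ inner ℝ (u m * ζ m s) ξ) μ := by
  have h := IndepFun.variance_sum (μ := μ) (s := Finset.range M)
    (X := fun m s ↦ inner ℝ (u m * ζ m s) ξ) (fun m _ ↦ memLp_inner ((hL m).const_mul (u m)) ξ)
    (fun i _ j _ hij ↦ (hind.indepFun hij).comp (φ := fun z ↦ inner ℝ (u i * z) ξ)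
      (ψ := fun z ↦ inner ℝ (u j * z) ξ) (by fun_prop) (by fun_prop))
  rw [← h]
  congr 1
  ext s
  simp only [rotSum, sum_inner, Finset.sum_apply]

variable [IsProbabilityMeasure μ]

lemma cvar_eq_variance_add {Z : S → ℂ} (hZ : MemLp Z 2 μ) :
    cvar μ Z = variance (fun s ↦ inner ℝ (Z s) 1) μ +
      variance (fun s ↦ inner ℝ (Z s) Complex.I) μ := by
  have h1 := memLp_inner hZ 1
  have h2 := memLp_inner hZ Complex.I
  have hi : Integrable Z μ := hZ.integrable (by norm_num)
  rw [variance_eq_integral h1.aestronglyMeasurable.aemeasurable,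
    variance_eq_integral h2.aestronglyMeasurable.aemeasurable, cvar]
  simp only [inner_one_right, inner_I_right] at h1 h2 ⊢
  have hre : ∫ s, (Z s).re ∂μ = (∫ s, Z s ∂μ).re := integral_re hi
  have him : ∫ s, (Z s).im ∂μ = (∫ s, Z s ∂μ).im := integral_im hi
  rw [hre, him, ← integral_add]
  · congr 1
    ext s
    rw [Complex.sq_norm, Complex.normSq_apply, Complex.sub_re, Complex.sub_im]
    ring
  · exact (h1.sub (memLp_const _)).integrable_sq
  · exact (h2.sub (memLp_const _)).integrable_sq

lemma cvar_rotSum (hind : iIndepFun ζ μ) (hid : ∀ m, IdentDistrib (ζ m) (ζ 0) μ μ)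
    (hL : MemLp (ζ 0) 2 μ) (hu : ∀ m, ‖u m‖ = 1) (M : ℕ) :
    cvar μ (rotSum u ζ M) = M * cvar μ (ζ 0) := by
  have hLm : ∀ m, MemLp (ζ m) 2 μ := fun m ↦ (hid m).symm.memLp_snd hL
  rw [cvar_eq_variance_add (memLp_rotSum hLm M), variance_inner_rotSum hind hLm,
    variance_inner_rotSum hind hLm, ← Finset.sum_add_distrib]
  have : ∀ m ∈ Finset.range M, variance (fun s ↦ inner ℝ (u m * ζ m s) 1) μ +
      variance (fun s ↦ inner ℝ (u m * ζ m s) Complex.I) μ = cvar μ (ζ 0) := fun m _ ↦ by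
    rw [← cvar_eq_variance_add ((hLm m).const_mul (u m)), cvar_const_mul (hu m),
      cvar_eq_of_identDistrib (hid m)]
  rw [Finset.sum_congr rfl this, Finset.sum_const, Finset.card_range, nsmul_eq_mul]

lemma integral_rotSum (hid : ∀ m, IdentDistrib (ζ m) (ζ 0) μ μ) (hL : MemLp (ζ 0) 2 μ) (M : ℕ) :
    ∫ s, rotSum u ζ M s ∂μ = ∑ m ∈ Finset.range M, u m * ∫ s, ζ 0 s ∂μ := by
  have hLm : ∀ m, MemLp (ζ m) 2 μ := fun m ↦ (hid m).symm.memLp_snd hL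
  simp only [rotSum]
  rw [integral_finsetSum _ fun m _ ↦ ((hLm m).integrable (by norm_num)).const_mul (u m)]
  simp_rw [integral_const_mul]
  exact Finset.sum_congr rfl fun m _ ↦ by rw [(hid m).integral_eq]

variable {ζ' : ℕ → S → ℂ} {u' : ℕ → ℂ}

lemma cvar_add {Z Z' : S → ℂ} (hZ : MemLp Z 2 μ) (hZ' : MemLp Z' 2 μ) (h : IndepFun Z Z' μ) :
    cvar μ (fun s ↦ Z s + Z' s) = cvar μ Z + cvar μ Z' := by
  rw [cvar_eq_variance_add (Z := fun s ↦ Z s + Z' s) (hZ.add hZ'),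
    cvar_eq_variance_add hZ, cvar_eq_variance_add hZ']
  rw [variance_inner_add hZ hZ' h, variance_inner_add hZ hZ' h]
  ring

lemma tendsto_lindebergError {Z : S → ℂ} (hZ : MemLp Z 2 μ) :
    Tendsto (lindebergError μ Z) (𝓝[≥] 0) (𝓝 0) := by
  have h1 := (tendsto_truncMoment hZ).const_mul 4
  have h2 : Tendsto (fun r : ℝ ↦ r ^ 2 * cvar μ Z ^ 2) (𝓝[≥] 0) (𝓝 (0 ^ 2 * cvar μ Z ^ 2)) :=
    ((Continuous.tendsto (by fun_prop) 0).mono_left nhdsWithin_le_nhds)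
  have h3 := (h1.add h2).div_const (cvar μ Z)
  simp only [mul_zero, zero_pow two_ne_zero, zero_mul, add_zero, zero_div] at h3
  exact h3

lemma mul_le_lindebergError {Z : S → ℂ} (hZ : MemLp Z 2 μ) {M r σ : ℝ} (hr : 0 ≤ r)
    (hM : M * cvar μ Z ≤ σ) :
    M * r ^ 2 * (4 * truncMoment μ Z r + r ^ 2 * cvar μ Z ^ 2) ≤
      σ * r ^ 2 * lindebergError μ Z r := by
  rw [lindebergError]
  have hT := truncMoment_nonneg (μ := μ) Z hr
  rcases (cvar_nonneg (μ := μ) (Z := Z)).eq_or_lt with h | h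
  · rw [truncMoment_eq_zero hZ h.symm, ← h]; simp
  · have : M ≤ σ / cvar μ Z := by rwa [le_div_iff₀ h]
    calc _ ≤ σ / cvar μ Z * r ^ 2 * (4 * truncMoment μ Z r + r ^ 2 * cvar μ Z ^ 2) := by gcongr
      _ = _ := by ring

/-- Characteristic function of the centred sum of two independent families of rotated i.i.d. complex
random variables. -/
lemma norm_charFun_centred_sum_sub_le (hind : iIndepFun ζ μ)
    (hid : ∀ m, IdentDistrib (ζ m) (ζ 0) μ μ) (hL : MemLp (ζ 0) 2 μ) (hu : ∀ m, ‖u m‖ = 1)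
    (hind' : iIndepFun ζ' μ)
    (hid' : ∀ m, IdentDistrib (ζ' m) (ζ' 0) μ μ) (hL' : MemLp (ζ' 0) 2 μ) (hu' : ∀ m, ‖u' m‖ = 1)
    (M N : ℕ) (hI : IndepFun (rotSum u ζ M) (rotSum u' ζ' N) μ) (ξ : ℂ) :
    ‖charFun (μ.map fun s ↦ rotSum u ζ M s + rotSum u' ζ' N s -
        ∫ s, (rotSum u ζ M s + rotSum u' ζ' N s) ∂μ) ξ -
      Complex.exp (-(variance (fun s ↦ inner ℝ (rotSum u ζ M s + rotSum u' ζ' N s) ξ) μ / 2 : ℝ))‖ ≤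
    cvar μ (fun s ↦ rotSum u ζ M s + rotSum u' ζ' N s) * ‖ξ‖ ^ 2 *
      (lindebergError μ (ζ 0) ‖ξ‖ + lindebergError μ (ζ' 0) ‖ξ‖) := by
  have hLm : ∀ m, MemLp (ζ m) 2 μ := fun m ↦ (hid m).symm.memLp_snd hL
  have hLm' : ∀ m, MemLp (ζ' m) 2 μ := fun m ↦ (hid' m).symm.memLp_snd hL'
  have hR := memLp_rotSum (u := u) hLm M
  have hR' := memLp_rotSum (u := u') hLm' N
  have hσ := cvar_add hR hR' hI
  rw [cvar_rotSum hind hid hL hu, cvar_rotSum hind' hid' hL' hu'] at hσ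
  set e := ∫ s, ζ 0 s ∂μ with he
  set e' := ∫ s, ζ' 0 s ∂μ with he'
  have hc : ∀ s, rotSum u ζ M s + rotSum u' ζ' N s -
      ∫ s, (rotSum u ζ M s + rotSum u' ζ' N s) ∂μ =
      ∑ m ∈ Finset.range M, u m * (ζ m s - e) + ∑ m ∈ Finset.range N, u' m * (ζ' m s - e') := by
    intro s
    rw [integral_add (hR.integrable (by norm_num)) (hR'.integrable (by norm_num)),
      integral_rotSum hid hL, integral_rotSum hid' hL']
    simp only [rotSum, mul_sub, Finset.sum_sub_distrib]
    ring
  simp_rw [hc]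
  have hcR : ∀ (v : ℕ → ℂ) (η : ℕ → S → ℂ) (f : ℂ) (K : ℕ),
      (fun s ↦ ∑ m ∈ Finset.range K, v m * (η m s - f)) =
      fun s ↦ rotSum v η K s - ∑ m ∈ Finset.range K, v m * f := by
    intro v η f K
    ext s
    simp only [rotSum, mul_sub, Finset.sum_sub_distrib]
  have hI2 : IndepFun (fun s ↦ ∑ m ∈ Finset.range M, u m * (ζ m s - e))
      (fun s ↦ ∑ m ∈ Finset.range N, u' m * (ζ' m s - e')) μ := by
    rw [hcR, hcR]
    exact hI.comp (φ := fun z ↦ z - ∑ m ∈ Finset.range M, u m * e)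
      (ψ := fun z ↦ z - ∑ m ∈ Finset.range N, u' m * e') (by fun_prop) (by fun_prop)
  have hm2 : AEMeasurable (fun s ↦ ∑ m ∈ Finset.range M, u m * (ζ m s - e)) μ := by
    rw [hcR]; exact hR.aestronglyMeasurable.aemeasurable.sub_const _
  have hm2' : AEMeasurable (fun s ↦ ∑ m ∈ Finset.range N, u' m * (ζ' m s - e')) μ := by
    rw [hcR]; exact hR'.aestronglyMeasurable.aemeasurable.sub_const _
  have hp := Measure.isProbabilityMeasure_map (μ := μ) hm2
  rw [hI2.charFun_map_fun_add_eq_mul hm2 hm2', variance_inner_add hR hR' hI,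
    variance_inner_rotSum hind hLm, variance_inner_rotSum hind' hLm', add_div, Complex.ofReal_add,
    neg_add, Complex.exp_add, Pi.mul_apply]
  refine (norm_mul_sub_mul_le (norm_charFun_le_one _) ?_).trans ?_
  · rw [← Complex.ofReal_neg, Complex.norm_exp_ofReal]
    exact Real.exp_le_one_iff.2 (neg_nonpos.2 (div_nonneg
      (Finset.sum_nonneg fun m _ ↦ variance_nonneg _ _) zero_le_two))
  have hv := cvar_nonneg (μ := μ) (Z := ζ 0)
  have hv' := cvar_nonneg (μ := μ) (Z := ζ' 0)
  rw [mul_add]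
  refine add_le_add
    ((norm_charFun_rotated_sum_sub_le hind hid hL hu M ξ).trans
      (mul_le_lindebergError hL (norm_nonneg ξ) ?_))
    ((norm_charFun_rotated_sum_sub_le hind' hid' hL' hu' N ξ).trans
      (mul_le_lindebergError hL' (norm_nonneg ξ) ?_))
  · rw [hσ]; linarith [mul_nonneg (Nat.cast_nonneg N) hv']
  · rw [hσ]; linarith [mul_nonneg (Nat.cast_nonneg M) hv]

end Group

section Model

variable {S : Type*}

/-- Phasor of a RIS column, without its deterministic phase. -/
noncomputable def risPhasor (X : Randomness S) (m : ℕ) (s : S) : ℂ :=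
  X.c m s * Complex.exp (X.δ m s * Complex.I)

/-- Phasor of a direct multipath component at time `t`. -/
noncomputable def directPhasor (X : Randomness S) (t : ℝ) (n : ℕ) (s : S) : ℂ :=
  X.b n s * Complex.exp ((X.ω n s * t + X.θ n s : ℝ) * Complex.I)

/-- Deterministic phase factor of a RIS column. -/
noncomputable def risRotation (g : Config) (t : ℝ) (m : ℕ) : ℂ :=
  Complex.exp ((g.ω₀ * t + g.θ₀ - g.ε * (m + 1) + g.φ m : ℝ) * Complex.I)

lemma norm_risRotation (g : Config) (t : ℝ) (m : ℕ) : ‖risRotation g t m‖ = 1 :=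
  Complex.norm_exp_ofReal_mul_I _

lemma ofReal_cos_add_I_mul_sin (x : ℝ) :
    ((Real.cos x : ℝ) : ℂ) + Complex.I * (Real.sin x : ℝ) = Complex.exp (x * Complex.I) := by
  rw [Complex.exp_mul_I]
  push_cast
  ring

lemma complexEnvelope_eq (X : Randomness S) (g : Config) (t : ℝ) (M N : ℕ) (s : S) :
    complexEnvelope X g t M N s =
      rotSum (risRotation g t) (risPhasor X) M s + rotSum 1 (directPhasor X t) N s := by
  have h1 : ∀ m, risRotation g t m * risPhasor X m s =
      ((X.c m s * Real.cos (g.ω₀ * t + g.θ₀ - g.ε * (m + 1) + (g.φ m + X.δ m s)) : ℝ) : ℂ) +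
      Complex.I *
      ((X.c m s * Real.sin (g.ω₀ * t + g.θ₀ - g.ε * (m + 1) + (g.φ m + X.δ m s)) : ℝ) : ℂ) := by
    intro m
    rw [Complex.ofReal_mul, Complex.ofReal_mul, mul_left_comm Complex.I, ← mul_add,
      ofReal_cos_add_I_mul_sin, risRotation, risPhasor, mul_left_comm, ← Complex.exp_add]
    congr 2
    push_cast
    ring
  have h2 : ∀ n, (1 : ℕ → ℂ) n * directPhasor X t n s =
      ((X.b n s * Real.cos (X.ω n s * t + X.θ n s) : ℝ) : ℂ) +
      Complex.I * ((X.b n s * Real.sin (X.ω n s * t + X.θ n s) : ℝ) : ℂ) := by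
    intro n
    rw [Complex.ofReal_mul, Complex.ofReal_mul, mul_left_comm Complex.I, ← mul_add,
      ofReal_cos_add_I_mul_sin, Pi.one_apply, one_mul, directPhasor]
  simp only [rotSum, h1, h2, complexEnvelope, Tc, Ts, Complex.ofReal_add, Complex.ofReal_sum,
    Finset.sum_add_distrib, ← Finset.mul_sum]
  ring

lemma complexEnvelope_re (X : Randomness S) (g : Config) (t : ℝ) (M N : ℕ) (s : S) :
    (complexEnvelope X g t M N s).re = Tc X g t M N s := by
  simp [complexEnvelope]

lemma complexEnvelope_im (X : Randomness S) (g : Config) (t : ℝ) (M N : ℕ) (s : S) :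
    (complexEnvelope X g t M N s).im = Ts X g t M N s := by
  simp [complexEnvelope]

variable [MeasurableSpace S] {μ : Measure S} {X : Randomness S}

namespace Randomness.IsIID

lemma identDistrib_risPhasor (hX : X.IsIID μ) (m : ℕ) :
    IdentDistrib (risPhasor X m) (risPhasor X 0) μ μ :=
  (hX.identDistrib_ris m).comp (u := fun p : ℝ × ℝ ↦ (p.1 : ℂ) * Complex.exp (p.2 * Complex.I))
    (by fun_prop)

lemma iIndepFun_risPhasor (hX : X.IsIID μ) : iIndepFun (risPhasor X) μ :=
  hX.iIndep_ris.comp (fun _ (p : ℝ × ℝ) ↦ (p.1 : ℂ) * Complex.exp (p.2 * Complex.I))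
    fun _ ↦ by fun_prop

lemma identDistrib_directPhasor (hX : X.IsIID μ) (t : ℝ) (n : ℕ) :
    IdentDistrib (directPhasor X t n) (directPhasor X t 0) μ μ :=
  (hX.identDistrib_direct n).comp (u := fun p : ℝ × ℝ × ℝ ↦
    (p.1 : ℂ) * Complex.exp ((p.2.1 * t + p.2.2 : ℝ) * Complex.I)) (by fun_prop)

lemma iIndepFun_directPhasor (hX : X.IsIID μ) (t : ℝ) : iIndepFun (directPhasor X t) μ :=
  hX.iIndep_direct.comp (fun _ (p : ℝ × ℝ × ℝ) ↦
    (p.1 : ℂ) * Complex.exp ((p.2.1 * t + p.2.2 : ℝ) * Complex.I)) fun _ ↦ by fun_prop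

lemma indepFun_rotSum (hX : X.IsIID μ) (u u' : ℕ → ℂ) (t : ℝ) (M N : ℕ) :
    IndepFun (rotSum u (risPhasor X) M) (rotSum u' (directPhasor X t) N) μ :=
  hX.indep.comp (φ := fun p : ℕ → ℝ × ℝ ↦ ∑ m ∈ Finset.range M,
      u m * (((p m).1 : ℂ) * Complex.exp ((p m).2 * Complex.I)))
    (ψ := fun p : ℕ → ℝ × ℝ × ℝ ↦ ∑ n ∈ Finset.range N, u' n * (((p n).1 : ℂ) *
      Complex.exp (((p n).2.1 * t + (p n).2.2 : ℝ) * Complex.I))) (by fun_prop) (by fun_prop)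

lemma memLp_risPhasor (hX : X.IsIID μ) : MemLp (risPhasor X 0) 2 μ := by
  refine hX.memLp_c.of_le (hX.identDistrib_risPhasor 0).aemeasurable_fst.aestronglyMeasurable
    (Eventually.of_forall fun s ↦ ?_)
  rw [risPhasor, norm_mul, Complex.norm_exp_ofReal_mul_I, mul_one, Complex.norm_real]

lemma memLp_directPhasor (hX : X.IsIID μ) (t : ℝ) : MemLp (directPhasor X t 0) 2 μ := by
  refine hX.memLp_b.of_le (hX.identDistrib_directPhasor t 0).aemeasurable_fst.aestronglyMeasurable
    (Eventually.of_forall fun s ↦ ?_)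
  rw [directPhasor, norm_mul, Complex.norm_exp_ofReal_mul_I, mul_one, Complex.norm_real]

lemma memLp_complexEnvelope (hX : X.IsIID μ) (g : Config) (t : ℝ) (M N : ℕ) :
    MemLp (complexEnvelope X g t M N) 2 μ := by
  have h : complexEnvelope X g t M N = fun s ↦
      rotSum (risRotation g t) (risPhasor X) M s + rotSum 1 (directPhasor X t) N s := by
    ext s; exact complexEnvelope_eq X g t M N s
  rw [h]
  exact (memLp_rotSum (fun m ↦ (hX.identDistrib_risPhasor m).symm.memLp_snd hX.memLp_risPhasor)
    M).add (memLp_rotSum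
      (fun m ↦ (hX.identDistrib_directPhasor t m).symm.memLp_snd (hX.memLp_directPhasor t)) N)

lemma memLp_Tc (hX : X.IsIID μ) (g : Config) (t : ℝ) (M N : ℕ) : MemLp (Tc X g t M N) 2 μ := by
  have := memLp_inner (hX.memLp_complexEnvelope g t M N) 1
  simpa only [inner_one_right, complexEnvelope_re] using this

lemma memLp_Ts (hX : X.IsIID μ) (g : Config) (t : ℝ) (M N : ℕ) : MemLp (Ts X g t M N) 2 μ := by
  have := memLp_inner (hX.memLp_complexEnvelope g t M N) Complex.I
  simpa only [inner_I_right, complexEnvelope_im] using this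

variable [IsProbabilityMeasure μ]

lemma sigma_eq_cvar (hX : X.IsIID μ) (g : Config) (t : ℝ) (M N : ℕ) :
    sigma X μ g t M N = cvar μ (complexEnvelope X g t M N) := by
  rw [cvar_eq_variance_add (hX.memLp_complexEnvelope g t M N), sigma]
  simp only [inner_one_right, inner_I_right, complexEnvelope_re, complexEnvelope_im]

lemma sigma_eq (hX : X.IsIID μ) (g : Config) (t : ℝ) (M N : ℕ) :
    sigma X μ g t M N = M * cvar μ (risPhasor X 0) + N * cvar μ (directPhasor X t 0) := by
  rw [hX.sigma_eq_cvar]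
  have h : complexEnvelope X g t M N = fun s ↦
      rotSum (risRotation g t) (risPhasor X) M s + rotSum 1 (directPhasor X t) N s := by
    ext s; exact complexEnvelope_eq X g t M N s
  rw [h, cvar_add
    (memLp_rotSum (fun m ↦ (hX.identDistrib_risPhasor m).symm.memLp_snd hX.memLp_risPhasor) M)
    (memLp_rotSum
      (fun m ↦ (hX.identDistrib_directPhasor t m).symm.memLp_snd (hX.memLp_directPhasor t)) N)
    (hX.indepFun_rotSum _ _ t M N),
    cvar_rotSum hX.iIndepFun_risPhasor hX.identDistrib_risPhasor hX.memLp_risPhasor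
      (norm_risRotation g t),
    cvar_rotSum (hX.iIndepFun_directPhasor t) (hX.identDistrib_directPhasor t)
      (hX.memLp_directPhasor t) (fun _ ↦ by simp)]

lemma XiSq_eq (hX : X.IsIID μ) (g : Config) (t : ℝ) (M N : ℕ) :
    XiSq X μ g t M N = ‖∫ s, complexEnvelope X g t M N s ∂μ‖ ^ 2 := by
  have hi := (hX.memLp_complexEnvelope g t M N).integrable (by norm_num)
  have hre : ∫ s, (complexEnvelope X g t M N s).re ∂μ = (∫ s, complexEnvelope X g t M N s ∂μ).re :=
    integral_re hi
  have him : ∫ s, (complexEnvelope X g t M N s).im ∂μ = (∫ s, complexEnvelope X g t M N s ∂μ).im :=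
    integral_im hi
  rw [Complex.sq_norm, Complex.normSq_apply, ← hre, ← him, XiSq]
  simp only [complexEnvelope_re, complexEnvelope_im]
  ring

lemma variance_inner_complexEnvelope (hX : X.IsIID μ) {g : Config} {t : ℝ} {M N : ℕ}
    (hB : Balanced X μ g t M N) (ξ : ℂ) :
    variance (fun s ↦ inner ℝ (complexEnvelope X g t M N s) ξ) μ =
      ‖ξ‖ ^ 2 * sigma X μ g t M N / 2 := by
  have hin : (fun s ↦ inner ℝ (complexEnvelope X g t M N s) ξ) =
      (fun s ↦ ξ.re * Tc X g t M N s) + fun s ↦ ξ.im * Ts X g t M N s := by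
    ext s
    simp only [Complex.inner, Complex.mul_re, Complex.conj_re, Complex.conj_im,
      complexEnvelope_re, complexEnvelope_im, Pi.add_apply]
    ring
  rw [hin, variance_add ((hX.memLp_Tc g t M N).const_mul _) ((hX.memLp_Ts g t M N).const_mul _),
    variance_const_mul, variance_const_mul, covariance_const_mul_left, covariance_const_mul_right,
    hB.2.2, sigma, hB.2.1, Complex.sq_norm, Complex.normSq_apply]
  ring

/-- The normalised fluctuation of the complex envelope has nearly the characteristic function of the
circularly symmetric Gaussian law, uniformly in the configuration. -/
lemma exists_forall_norm_charFun_sub_le (hX : X.IsIID μ) (t : ℝ) (ξ : ℂ) {ε : ℝ} (hε : 0 < ε) :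
    ∃ n₀ : ℕ, ∀ M N : ℕ, n₀ ≤ M → n₀ ≤ N → ∀ g : Config, Balanced X μ g t M N →
      ‖charFun (μ.map fun s ↦ (√(sigma X μ g t M N))⁻¹ •
        (complexEnvelope X g t M N s - ∫ s, complexEnvelope X g t M N s ∂μ)) ξ -
        charFun complexGaussian ξ‖ ≤ ε := by
  set v := cvar μ (risPhasor X 0) + cvar μ (directPhasor X t 0) with hv
  have hv1 := cvar_nonneg (μ := μ) (Z := risPhasor X 0)
  have hv2 := cvar_nonneg (μ := μ) (Z := directPhasor X t 0)
  rcases (add_nonneg hv1 hv2).eq_or_lt with h0 | h0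
  · refine ⟨0, fun M N _ _ g hB ↦ ?_⟩
    have h1 : cvar μ (risPhasor X 0) = 0 := by linarith
    have h2 : cvar μ (directPhasor X t 0) = 0 := by linarith
    have := hB.1
    rw [hX.sigma_eq, h1, h2] at this
    simp at this
  have hlim : Tendsto (fun n : ℕ ↦ (√(n * v))⁻¹ * ‖ξ‖) atTop (𝓝[≥] 0) := by
    refine tendsto_nhdsWithin_iff.2 ⟨?_, Eventually.of_forall fun n ↦ by
      simp only [mem_Ici]; positivity⟩
    have h1 : Tendsto (fun n : ℕ ↦ √(n * v)) atTop atTop :=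
      Real.tendsto_sqrt_atTop.comp (tendsto_natCast_atTop_atTop.atTop_mul_const h0)
    simpa using h1.inv_tendsto_atTop.mul_const ‖ξ‖
  have herr := ((tendsto_lindebergError hX.memLp_risPhasor).add
    (tendsto_lindebergError (hX.memLp_directPhasor t))).const_mul (‖ξ‖ ^ 2)
  rw [add_zero, mul_zero] at herr
  obtain ⟨r₀, hr₀, hr₁⟩ : ∃ r₀ : ℝ, 0 < r₀ ∧ ∀ r, 0 ≤ r → r < r₀ → ‖ξ‖ ^ 2 *
      (lindebergError μ (risPhasor X 0) r + lindebergError μ (directPhasor X t 0) r) ≤ ε := by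
    have := (herr.eventually (ge_mem_nhds hε))
    rw [eventually_nhdsWithin_iff, Metric.eventually_nhds_iff] at this
    obtain ⟨r₀, hr₀, h⟩ := this
    refine ⟨r₀, hr₀, fun r hr hr' ↦ h ?_ hr⟩
    rwa [Real.dist_eq, sub_zero, abs_of_nonneg hr]
  have hlim' := tendsto_nhdsWithin_iff.1 hlim |>.1
  obtain ⟨n₀, hn₀⟩ := (hlim'.eventually (gt_mem_nhds hr₀)).and (eventually_ge_atTop 1) |>.exists
  refine ⟨n₀, fun M N hM hN g hB ↦ ?_⟩
  set σ := sigma X μ g t M N with hσ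
  have hσ0 : 0 < σ := hB.1
  have hs0 : 0 < √σ := Real.sqrt_pos.2 hσ0
  have hσn : n₀ * v ≤ σ := by
    rw [hσ, hX.sigma_eq, hv, mul_add]
    gcongr
  have hmE := (hX.memLp_complexEnvelope g t M N).aestronglyMeasurable.aemeasurable
  rw [charFun_map_smul_comp (hmE.sub_const _)]
  set η : ℂ := (√σ)⁻¹ • ξ with hη
  have hηn : ‖η‖ = (√σ)⁻¹ * ‖ξ‖ := by
    rw [hη, norm_smul, Real.norm_of_nonneg (by positivity)]
  have hησ : σ * ‖η‖ ^ 2 = ‖ξ‖ ^ 2 := by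
    rw [hηn, mul_pow, inv_pow, Real.sq_sqrt hσ0.le]
    field_simp
  have key := norm_charFun_centred_sum_sub_le (u := risRotation g t) (u' := 1)
    hX.iIndepFun_risPhasor hX.identDistrib_risPhasor
    hX.memLp_risPhasor (norm_risRotation g t) (hX.iIndepFun_directPhasor t)
    (hX.identDistrib_directPhasor t) (hX.memLp_directPhasor t) (fun _ ↦ by simp) M N
    (hX.indepFun_rotSum _ _ t M N) η
  simp_rw [← complexEnvelope_eq] at key
  rw [hX.variance_inner_complexEnvelope hB] at key
  have hσc : cvar μ (fun s ↦ complexEnvelope X g t M N s) = σ := (hX.sigma_eq_cvar g t M N).symm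
  rw [hσc, hησ] at key
  rw [charFun_complexGaussian]
  have h4 : ‖ξ‖ ^ 2 / 4 = ‖η‖ ^ 2 * σ / 2 / 2 := by rw [← hησ]; ring
  rw [h4]
  refine key.trans (hr₁ _ (norm_nonneg _) ?_)
  refine lt_of_le_of_lt ?_ hn₀.1
  rw [hηn]
  have : 0 < (n₀ : ℝ) * v := mul_pos (by exact_mod_cast hn₀.2) h0
  gcongr

/-- The normalised fluctuation of the complex envelope is nearly Gaussian on all discs, uniformly in
the configuration. -/
lemma exists_forall_abs_measure_disc_sub_le (hX : X.IsIID μ) (t : ℝ) {η : ℝ} (hη : 0 < η) :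
    ∃ n₀ : ℕ, ∀ M N : ℕ, n₀ ≤ M → n₀ ≤ N → ∀ g : Config, Balanced X μ g t M N →
      ∀ (a : ℂ) (r : ℝ), |(μ.map fun s ↦ (√(sigma X μ g t M N))⁻¹ •
        (complexEnvelope X g t M N s - ∫ s, complexEnvelope X g t M N s ∂μ)).real {z | dist z a ≤ r} -
        complexGaussian.real {z | dist z a ≤ r}| ≤ η := by
  by_contra! hcon
  choose M N hM hN g hB a r hbad using hcon
  have hm : ∀ k, AEMeasurable (fun s ↦ (√(sigma X μ (g k) t (M k) (N k)))⁻¹ •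
      (complexEnvelope X (g k) t (M k) (N k) s - ∫ s, complexEnvelope X (g k) t (M k) (N k) s ∂μ))
      μ := fun k ↦ by
    have := (hX.memLp_complexEnvelope (g k) t (M k) (N k)).aestronglyMeasurable.aemeasurable
    fun_prop
  let ν : ℕ → ProbabilityMeasure ℂ := fun k ↦ ⟨_, Measure.isProbabilityMeasure_map (hm k)⟩
  let ν₀ : ProbabilityMeasure ℂ := ⟨complexGaussian, inferInstance⟩
  have hν : Tendsto ν atTop (𝓝 ν₀) := by
    refine ProbabilityMeasure.tendsto_of_tendsto_charFun fun ξ ↦ ?_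
    rw [Metric.tendsto_atTop]
    intro ε hε
    obtain ⟨n₀, hn₀⟩ := hX.exists_forall_norm_charFun_sub_le t ξ (half_pos hε)
    refine ⟨n₀, fun k hk ↦ ?_⟩
    rw [dist_eq_norm]
    exact (hn₀ _ _ (hk.trans (hM k)) (hk.trans (hN k)) (g k) (hB k)).trans_lt (half_lt_self hε)
  have h := eventually_forall_abs_sub_sublevel_le hν
    (F := {f | ∃ a : ℂ, f = fun z ↦ dist z a})
    (by rintro _ ⟨a, rfl⟩; exact LipschitzWith.dist_left a) (C := 2) zero_le_two
    (by rintro _ ⟨a, rfl⟩ r ε hε; exact complexGaussian_real_annulus_le a r hε) hη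
  obtain ⟨k, hk⟩ := h.exists
  exact absurd (hk _ ⟨a k, rfl⟩ (r k)) (not_le.2 (hbad k))

/-- Rician approximation of the envelope. -/
lemma exists_forall_envelopeWithin_rician (hX : X.IsIID μ) (t : ℝ) {η : ℝ} (hη : 0 < η) :
    ∃ n₀ : ℕ, ∀ M N : ℕ, n₀ ≤ M → n₀ ≤ N → ∀ g : Config, Balanced X μ g t M N →
      EnvelopeWithin X μ g t M N (ricianMeasure (KEff X μ g t M N) (scale X μ g t M N)) η := by
  obtain ⟨n₀, hn₀⟩ := hX.exists_forall_abs_measure_disc_sub_le t hη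
  refine ⟨n₀, fun M N hM hN g hB x ↦ ?_⟩
  set σ := sigma X μ g t M N with hσ
  have hσ0 : 0 < σ := hB.1
  have hs0 : 0 < √σ := Real.sqrt_pos.2 hσ0
  set e := ∫ s, complexEnvelope X g t M N s ∂μ with he
  have hm := (hX.memLp_complexEnvelope g t M N).aestronglyMeasurable.aemeasurable
  have hR := map_norm_sqrt_mul_add_complexGaussian hσ0 e
  rw [KEff, scale, hX.XiSq_eq, ← he, ← hσ, ← hR]
  have key := hn₀ M N hM hN g hB (-(e / √σ)) (x / √σ)
  have hdist : ∀ z : ℂ, dist z (-(e / √σ)) ≤ x / √σ ↔ ‖(√σ : ℂ) * z + e‖ ≤ x := by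
    intro z
    have hs' : (√σ : ℂ) ≠ 0 := by exact_mod_cast hs0.ne'
    have hz : (√σ : ℂ) * z + e = √σ * (z + e / √σ) := by field_simp
    have hn : ‖(√σ : ℂ)‖ = √σ := by rw [Complex.norm_real, Real.norm_of_nonneg hs0.le]
    rw [dist_eq_norm, sub_neg_eq_add, hz, norm_mul, hn, le_div_iff₀ hs0, mul_comm]
  simp only [hdist] at key
  have hcl : MeasurableSet {z : ℂ | ‖(√σ : ℂ) * z + e‖ ≤ x} :=
    measurableSet_le (by fun_prop) measurable_const
  have h1 : (μ.map fun s ↦ (√σ)⁻¹ • (complexEnvelope X g t M N s - e)).real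
      {z : ℂ | ‖(√σ : ℂ) * z + e‖ ≤ x} = μ.real {s | ‖complexEnvelope X g t M N s‖ ≤ x} := by
    rw [map_measureReal_apply_of_aemeasurable (by fun_prop) hcl]
    congr 1
    ext s
    have hs' : (√σ : ℂ) ≠ 0 := by exact_mod_cast hs0.ne'
    have : (√σ : ℂ) * ((√σ)⁻¹ • (complexEnvelope X g t M N s - e)) + e =
        complexEnvelope X g t M N s := by
      rw [Complex.real_smul, Complex.ofReal_inv, mul_inv_cancel_left₀ hs', sub_add_cancel]
    simp only [mem_preimage, mem_ofPred_eq, this]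
  have h2 : (complexGaussian.map fun z ↦ ‖(√σ : ℂ) * z + e‖).real (Iic x) =
      complexGaussian.real {z : ℂ | ‖(√σ : ℂ) * z + e‖ ≤ x} := by
    rw [map_measureReal_apply (by fun_prop) measurableSet_Iic]
    rfl
  rw [h1] at key
  rw [h2]
  exact key

end Randomness.IsIID

end Model

lemma gammaMeasure_eq_withDensity_Ioi (m : ℝ) :
    gammaMeasure m 1 = (volume.restrict (Ioi 0)).withDensity (gammaPDF m 1) := by
  rw [gammaMeasure, withDensity_congr_ae (g := (Ioi (0 : ℝ)).indicator (gammaPDF m 1)),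
    withDensity_indicator measurableSet_Ioi]
  have h0 : ∀ᵐ x : ℝ, x ≠ 0 := by
    simp [ae_iff, measure_singleton]
  filter_upwards [h0] with x hx
  rcases hx.lt_or_gt with h | h
  · rw [indicator_of_notMem (by simpa using h.le), gammaPDF_of_neg h]
  · rw [indicator_of_mem (mem_Ioi.2 h)]

/-- The square of a Nakagami variable is gamma distributed. -/
lemma map_nakagamiMeasure {m Ωp : ℝ} (hm : 0 < m) (hΩ : 0 < Ωp) :
    (nakagamiMeasure m Ωp).map (fun x ↦ m * x ^ 2 / Ωp) = gammaMeasure m 1 := by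
  have himg : (fun x : ℝ ↦ m * x ^ 2 / Ωp) '' Ioi 0 = Ioi 0 := by
    ext y
    constructor
    · rintro ⟨x, hx, rfl⟩
      have : (0 : ℝ) < x := hx
      simp only [mem_Ioi]; positivity
    · intro hy
      have hy' : (0 : ℝ) < y := hy
      refine ⟨√(Ωp * y / m), Real.sqrt_pos.2 (by positivity), ?_⟩
      simp only
      rw [Real.sq_sqrt (by positivity)]
      field_simp
  have hinj : InjOn (fun x : ℝ ↦ m * x ^ 2 / Ωp) (Ioi 0) := by
    intro x hx y hy h
    have hx' : (0 : ℝ) < x := hx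
    have hy' : (0 : ℝ) < y := hy
    simp only at h
    have h2 : x ^ 2 = y ^ 2 := by field_simp at h; exact h
    exact (pow_left_inj₀ hx'.le hy'.le two_ne_zero).1 h2
  have h := map_withDensity_Ioi (φ := fun x ↦ m * x ^ 2 / Ωp) (φ' := fun x ↦ m * (2 * x) / Ωp)
    (by fun_prop) (fun x _ ↦ by
      have := (((hasDerivAt_id x).pow 2).const_mul m).div_const Ωp
      simpa using this.hasDerivWithinAt) hinj himg (gammaPDF m 1)
  rw [gammaMeasure_eq_withDensity_Ioi, ← h, nakagamiMeasure]
  congr 1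
  refine withDensity_congr_ae ?_
  filter_upwards [ae_restrict_mem measurableSet_Ioi] with x hx
  have hx' : (0 : ℝ) < x := hx
  rw [gammaPDF_of_nonneg (by positivity), ← ENNReal.ofReal_mul (by positivity),
    abs_of_pos (by positivity), nakagamiPDF]
  congr 1
  rw [Real.one_rpow, Real.div_rpow (by positivity) hΩ.le, Real.mul_rpow hm.le (by positivity),
    ← Real.rpow_natCast x 2, ← Real.rpow_mul hx'.le, Real.rpow_sub_one hm.ne',
    Real.rpow_sub_one hΩ.ne']
  have h3 : x ^ (((2 : ℕ) : ℝ) * (m - 1)) = x ^ (2 * m - 1) / x := by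
    rw [← Real.rpow_sub_one hx'.ne']
    congr 1
    push_cast; ring
  rw [h3]
  have hG := Real.Gamma_pos_of_pos hm
  have hp : 0 < Ωp ^ m := by positivity
  have he : -m * x ^ ((2 : ℕ) : ℝ) / Ωp = -(1 * (m * x ^ ((2 : ℕ) : ℝ) / Ωp)) := by ring
  rw [he]
  field_simp

lemma integral_rpow_mul_gamma {m b : ℝ} (hm : 0 < m) (hb : 0 < b) :
    ∫ x in Ioi (0 : ℝ), (Real.Gamma m)⁻¹ * (x ^ (m - 1) * Real.exp (-(b * x))) = b ^ (-m) := by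
  rw [integral_const_mul, Real.integral_rpow_mul_exp_neg_mul_Ioi hm hb]
  have hG := Real.Gamma_pos_of_pos hm
  rw [one_div, Real.inv_rpow hb.le, Real.rpow_neg hb.le]
  field_simp

lemma integral_gammaMeasure {m : ℝ} (hm : 0 < m) (f : ℝ → ℝ) :
    ∫ x, f x ∂(gammaMeasure m 1) =
      ∫ x in Ioi (0 : ℝ), (Real.Gamma m)⁻¹ * (x ^ (m - 1) * Real.exp (-x)) * f x := by
  rw [gammaMeasure_eq_withDensity_Ioi]
  have hd : gammaPDF m 1 = fun x ↦ ((Real.toNNReal (gammaPDFReal m 1 x) : NNReal) : ENNReal) := rfl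
  rw [hd, integral_withDensity_eq_integral_smul (measurable_gammaPDFReal m 1).real_toNNReal]
  refine setIntegral_congr_fun measurableSet_Ioi fun x hx ↦ ?_
  have hx' : (0 : ℝ) < x := hx
  rw [NNReal.smul_def, Real.coe_toNNReal _ (gammaPDFReal_nonneg hm one_pos x), gammaPDFReal,
    if_pos hx'.le, smul_eq_mul, Real.one_rpow, one_div, one_mul, mul_assoc (Real.Gamma m)⁻¹]

lemma mgf_gammaMeasure {m t : ℝ} (hm : 0 < m) (ht : t < 1) :
    mgf id (gammaMeasure m 1) t = (1 - t) ^ (-m) := by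
  rw [mgf, integral_gammaMeasure hm, ← integral_rpow_mul_gamma hm (b := 1 - t) (by linarith)]
  congr 1
  ext x
  rw [mul_assoc, mul_assoc, ← Real.exp_add]
  congr 3
  simp only [id]
  ring

lemma integrable_exp_gammaMeasure {m t : ℝ} (hm : 0 < m) (ht : t < 1) :
    t ∈ integrableExpSet id (gammaMeasure m 1) := by
  by_contra h
  have h1 := mgf_gammaMeasure hm ht
  rw [mgf, integral_undef h] at h1
  have : 0 < (1 - t) ^ (-m) := Real.rpow_pos_of_pos (by linarith) _
  exact this.ne h1

lemma complexMGF_gammaMeasure {m : ℝ} (hm : 0 < m) {z : ℂ} (hz : z.re < 1) :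
    complexMGF id (gammaMeasure m 1) z = Complex.exp (-m * Complex.log (1 - z)) := by
  have hopen : IsOpen {z : ℂ | z.re < 1} := isOpen_lt Complex.continuous_re continuous_const
  have hsub : ∀ z : ℂ, z.re < 1 → z.re ∈ interior (integrableExpSet id (gammaMeasure m 1)) :=
    fun z hz ↦ interior_maximal (fun t ht ↦ integrable_exp_gammaMeasure hm ht) isOpen_Iio hz
  have hf : AnalyticOnNhd ℂ (complexMGF id (gammaMeasure m 1)) {z : ℂ | z.re < 1} :=
    fun z hz ↦ analyticAt_complexMGF (hsub z hz)
  have hg : AnalyticOnNhd ℂ (fun z ↦ Complex.exp (-m * Complex.log (1 - z))) {z : ℂ | z.re < 1} := by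
    refine DifferentiableOn.analyticOnNhd (fun z hz ↦ ?_) hopen
    have hs : 1 - z ∈ Complex.slitPlane := Or.inl (by
      have : z.re < 1 := hz
      simpa using this)
    exact ((((differentiableAt_const _).sub differentiableAt_id).clog hs).const_mul
      _).cexp.differentiableWithinAt
  have hconv : IsPreconnected {z : ℂ | z.re < 1} :=
    (convex_halfSpace_re_lt 1).isPreconnected
  refine hf.eqOn_of_preconnected_of_frequently_eq hg hconv (z₀ := 0) (by simp) ?_ hz
  have ht : Tendsto (fun x : ℝ ↦ (x : ℂ)) (𝓝[≠] 0) (𝓝[≠] 0) := by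
    refine tendsto_nhdsWithin_iff.2 ⟨?_, ?_⟩
    · exact (Complex.continuous_ofReal.tendsto' 0 0 (by simp)).mono_left nhdsWithin_le_nhds
    · filter_upwards [self_mem_nhdsWithin] with x hx
      simpa using hx
  refine ht.frequently (Eventually.frequently ?_)
  have : ∀ᶠ x : ℝ in 𝓝[≠] 0, x < 1 :=
    (gt_mem_nhds one_pos).filter_mono nhdsWithin_le_nhds
  filter_upwards [this] with x hx
  rw [complexMGF_ofReal, mgf_gammaMeasure hm hx, Real.rpow_def_of_pos (by linarith),
    Complex.ofReal_exp]
  congr 1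
  push_cast
  rw [Complex.ofReal_log (by linarith)]
  push_cast
  ring

/-- The standardised gamma law. -/
noncomputable def stdGamma (m : ℝ) : Measure ℝ :=
  (gammaMeasure m 1).map fun y ↦ (√m)⁻¹ * y + -√m

lemma isProbabilityMeasure_stdGamma {m : ℝ} (hm : 0 < m) : IsProbabilityMeasure (stdGamma m) := by
  have := isProbabilityMeasure_gammaMeasure hm one_pos
  exact Measure.isProbabilityMeasure_map (by fun_prop)

lemma charFun_stdGamma {m : ℝ} (hm : 0 < m) (ξ : ℝ) :
    charFun (stdGamma m) ξ =
      Complex.exp (-m * Complex.log (1 - ((√m)⁻¹ * ξ : ℝ) * Complex.I) - √m * ξ * Complex.I) := by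
  have h1 : stdGamma m = ((gammaMeasure m 1).map fun y ↦ (√m)⁻¹ * y).map fun y ↦ y + -√m := by
    rw [stdGamma, Measure.map_map (by fun_prop) (by fun_prop)]
    rfl
  rw [h1, charFun_map_add_const, charFun_map_mul, ← complexMGF_id_mul_I,
    complexMGF_gammaMeasure hm (by simp), ← Complex.exp_add]
  congr 1
  simp
  ring

lemma tendsto_charFun_stdGamma_one {m : ℕ → ℝ} (hm : Tendsto m atTop (𝓝 1))
    (hm0 : ∀ k, 0 < m k) (ξ : ℝ) :
    Tendsto (fun k ↦ charFun (stdGamma (m k)) ξ) atTop (𝓝 (charFun (stdGamma 1) ξ)) := by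
  rw [charFun_stdGamma one_pos]
  simp_rw [charFun_stdGamma (hm0 _)]
  have hc : ContinuousAt (fun m : ℝ ↦ Complex.exp (-m * Complex.log
      (1 - ((√m)⁻¹ * ξ : ℝ) * Complex.I) - √m * ξ * Complex.I)) 1 := by
    have h1 : ContinuousAt (fun m : ℝ ↦ (√m)⁻¹) 1 :=
      (Real.continuous_sqrt.continuousAt).inv₀ (by simp)
    have h2 : ContinuousAt (fun m : ℝ ↦ (1 : ℂ) - ((√m)⁻¹ * ξ : ℝ) * Complex.I) 1 := by
      fun_prop
    have h3 := h2.clog (Or.inl (by simp))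
    fun_prop
  have := hc.tendsto.comp hm
  simpa [Function.comp_def] using this

lemma tendsto_charFun_stdGamma_atTop {m : ℕ → ℝ} (hm : Tendsto m atTop atTop)
    (hm0 : ∀ k, 0 < m k) (ξ : ℝ) :
    Tendsto (fun k ↦ charFun (stdGamma (m k)) ξ) atTop (𝓝 (charFun (gaussianReal 0 1) ξ)) := by
  simp_rw [charFun_stdGamma (hm0 _)]
  rw [charFun_gaussianReal]
  refine (Complex.continuous_exp.tendsto _).comp ?_
  have hs : Tendsto (fun k ↦ √(m k)) atTop atTop := Real.tendsto_sqrt_atTop.comp hm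
  have hsi : Tendsto (fun k ↦ (√(m k))⁻¹) atTop (𝓝 0) := hs.inv_tendsto_atTop
  rw [tendsto_iff_norm_sub_tendsto_zero]
  have hbound : Tendsto (fun k ↦ (√(m k))⁻¹ * (2 * |ξ| ^ 3)) atTop (𝓝 0) := by
    simpa using hsi.mul_const (2 * |ξ| ^ 3)
  have hsmall : ∀ᶠ k in atTop, (√(m k))⁻¹ * |ξ| < 1 / 2 := by
    have : Tendsto (fun k ↦ (√(m k))⁻¹ * |ξ|) atTop (𝓝 0) := by simpa using hsi.mul_const |ξ|
    exact this.eventually (gt_mem_nhds (by norm_num))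
  refine squeeze_zero' (Eventually.of_forall fun k ↦ norm_nonneg _) ?_ hbound
  filter_upwards [hsmall] with k hk
  have hspos : 0 < √(m k) := Real.sqrt_pos.2 (hm0 k)
  set s := √(m k) with hsdef
  have hms : m k = s ^ 2 := (Real.sq_sqrt (hm0 k).le).symm
  set w : ℂ := -((s⁻¹ * ξ : ℝ) * Complex.I) with hw
  have hwn : ‖w‖ = s⁻¹ * |ξ| := by
    rw [hw, norm_neg, norm_mul, Complex.norm_I, mul_one, Complex.norm_real, Real.norm_eq_abs,
      abs_mul, abs_of_pos (inv_pos.2 hspos)]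
  have hlog := Complex.norm_log_sub_logTaylor_le 2 (z := w) (by rw [hwn]; linarith)
  have hT : Complex.logTaylor (2 + 1) w = w - w ^ 2 / 2 := by
    simp only [Complex.logTaylor, Finset.sum_range_succ, Finset.range_zero, Finset.sum_empty]
    norm_num
    ring
  rw [hT] at hlog
  have hsc : (s : ℂ) ≠ 0 := by exact_mod_cast hspos.ne'
  have hid : -(m k : ℂ) * Complex.log (1 - ((s⁻¹ * ξ : ℝ) : ℂ) * Complex.I) - s * ξ * Complex.I -
      (ξ * (0 : ℝ) * Complex.I - (1 : NNReal) * ξ ^ 2 / 2) =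
      -(s : ℂ) ^ 2 * (Complex.log (1 + w) - (w - w ^ 2 / 2)) := by
    rw [sub_eq_add_neg (1 : ℂ), ← hw, hms]
    have h1 : (s : ℂ) ^ 2 * w = -(s * ξ * Complex.I) := by
      rw [hw]; push_cast; field_simp
    have h2 : (s : ℂ) ^ 2 * w ^ 2 = -(ξ : ℂ) ^ 2 := by
      rw [hw, neg_sq, mul_pow, Complex.I_sq]; push_cast; field_simp
    push_cast
    linear_combination -h1 + h2 / 2
  have hgoal : ‖-(m k : ℂ) * Complex.log (1 - ((s⁻¹ * ξ : ℝ) : ℂ) * Complex.I) - s * ξ * Complex.I -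
      (ξ * (0 : ℝ) * Complex.I - (1 : NNReal) * ξ ^ 2 / 2)‖ ≤ s⁻¹ * (2 * |ξ| ^ 3) := by
    rw [hid, norm_mul, norm_neg, norm_pow, Complex.norm_real, Real.norm_of_nonneg hspos.le]
    have h4 : (1 - ‖w‖)⁻¹ ≤ 2 := by
      rw [inv_le_comm₀ (by rw [hwn]; linarith) two_pos, hwn]; linarith
    calc _ ≤ s ^ 2 * (‖w‖ ^ (2 + 1) * (1 - ‖w‖)⁻¹ / (2 + 1)) := by gcongr; exact_mod_cast hlog
      _ ≤ s ^ 2 * (‖w‖ ^ (2 + 1) * 2 / 1) := by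
        gcongr
        · norm_num
      _ = _ := by rw [hwn, mul_pow, inv_pow]; field_simp
  exact hgoal

/-- Linear combinations of the real part and the centred squared modulus. -/
noncomputable def quadForm (α β : ℝ) (z : ℂ) : ℝ := α * z.re + β * (‖z‖ ^ 2 - 1)

lemma continuous_quadForm (α β : ℝ) : Continuous (quadForm α β) := by
  unfold quadForm; fun_prop

/-- The law of a quadratic form under the circularly symmetric Gaussian law. -/
noncomputable def quadFormLaw (α β : ℝ) : ProbabilityMeasure ℝ :=
  ⟨complexGaussian.map (quadForm α β),
    Measure.isProbabilityMeasure_map (continuous_quadForm α β).aemeasurable⟩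

lemma tendsto_quadFormLaw {α β : ℕ → ℝ} {a b : ℝ} (hα : Tendsto α atTop (𝓝 a))
    (hβ : Tendsto β atTop (𝓝 b)) :
    Tendsto (fun k ↦ quadFormLaw (α k) (β k)) atTop (𝓝 (quadFormLaw a b)) := by
  rw [ProbabilityMeasure.tendsto_iff_forall_integral_tendsto]
  intro f
  have h : ∀ a b, ∫ x, f x ∂(quadFormLaw a b : Measure ℝ) =
      ∫ z, f (quadForm a b z) ∂complexGaussian := fun a b ↦
    integral_map (continuous_quadForm a b).aemeasurable f.continuous.aestronglyMeasurable
  simp_rw [h]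
  refine tendsto_integral_of_dominated_convergence (fun _ ↦ ‖f‖) ?_ (integrable_const _) ?_ ?_
  · exact fun k ↦ (f.continuous.comp (continuous_quadForm _ _)).aestronglyMeasurable
  · exact fun k ↦ Eventually.of_forall fun z ↦ f.norm_coe_le_norm _
  · refine Eventually.of_forall fun z ↦ (f.continuous.tendsto _).comp ?_
    exact (hα.mul_const _).add (hβ.mul_const _)

lemma besselI0_zero : besselI0 0 = 1 := by
  simp [besselI0, Real.pi_ne_zero]

lemma ricianMeasure_zero_one : ricianMeasure 0 1 = nakagamiMeasure 1 1 := by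
  rw [ricianMeasure, nakagamiMeasure]
  congr 1
  ext x
  congr 1
  have h := ricianPDF_add_one le_rfl x
  rw [zero_add] at h
  rw [h, nakagamiPDF]
  rw [show (2 : ℝ) * 1 - 1 = 1 by norm_num]
  simp [besselI0_zero]

lemma map_sq_norm_complexGaussian :
    complexGaussian.map (fun z ↦ ‖z‖ ^ 2) = gammaMeasure 1 1 := by
  have h := map_norm_add_complexGaussian 0
  simp only [add_zero, norm_zero, zero_pow two_ne_zero, zero_add, ricianMeasure_zero_one] at h
  rw [← map_nakagamiMeasure one_pos one_pos, ← h, Measure.map_map (by fun_prop) (by fun_prop)]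
  congr 1
  ext z
  simp

lemma quadFormLaw_zero_one : (quadFormLaw 0 1 : Measure ℝ) = stdGamma 1 := by
  rw [stdGamma, ← map_sq_norm_complexGaussian, Measure.map_map (by fun_prop) (by fun_prop)]
  change complexGaussian.map (quadForm 0 1) = _
  congr 1
  ext z
  simp [quadForm, sub_eq_add_neg]

lemma quadFormLaw_sqrt_two_zero : (quadFormLaw (√2) 0 : Measure ℝ) = gaussianReal 0 1 := by
  refine Measure.ext_of_charFun ?_
  ext ξ
  rw [charFun_gaussianReal, charFun_apply_real]
  change ∫ x, _ ∂(complexGaussian.map (quadForm (√2) 0)) = _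
  rw [integral_map (continuous_quadForm _ _).aemeasurable (by fun_prop)]
  have h := charFun_complexGaussian ((ξ * √2 : ℝ) : ℂ)
  rw [charFun_apply] at h
  have h2 : ∀ z : ℂ, Complex.exp (ξ * (quadForm (√2) 0 z : ℝ) * Complex.I) =
      Complex.exp ((inner ℝ z ((ξ * √2 : ℝ) : ℂ) : ℝ) * Complex.I) := by
    intro z
    congr 2
    rw [← Complex.ofReal_mul]
    congr 1
    simp [quadForm, Complex.inner]
    ring
  simp_rw [h2]
  rw [h, Complex.norm_real, Real.norm_eq_abs, sq_abs, mul_pow, Real.sq_sqrt zero_le_two]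
  congr 1
  push_cast
  ring

lemma gaussianReal_real_Ioc_le (r : ℝ) {ε : ℝ} (hε : 0 ≤ ε) :
    (gaussianReal 0 1).real (Ioc r (r + ε)) ≤ 1 * ε := by
  rw [measureReal_def]
  refine ENNReal.toReal_le_of_le_ofReal (by positivity) ?_
  rw [gaussianReal_apply _ one_ne_zero]
  calc _ ≤ ∫⁻ _ in Ioc r (r + ε), ENNReal.ofReal 1 := by
        refine lintegral_mono fun x ↦ ENNReal.ofReal_le_ofReal ?_
        rw [gaussianPDFReal]
        have h1 : 1 ≤ √(2 * Real.pi * (1 : NNReal)) := by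
          rw [Real.one_le_sqrt, NNReal.coe_one, mul_one]
          linarith [Real.pi_gt_three]
        refine mul_le_one₀ (inv_le_one_of_one_le₀ h1) (Real.exp_pos _).le
          (Real.exp_le_one_iff.2 ?_)
        have : 0 ≤ (x - 0) ^ 2 / (2 * ((1 : NNReal) : ℝ)) := by positivity
        rw [neg_div]
        linarith
    _ = _ := by simp

lemma stdGamma_one_real_Ioc_le (r : ℝ) {ε : ℝ} (hε : 0 ≤ ε) :
    (stdGamma 1).real (Ioc r (r + ε)) ≤ 1 * ε := by
  rw [stdGamma, map_measureReal_apply (by fun_prop) measurableSet_Ioc]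
  have hpre : (fun y : ℝ ↦ (√1)⁻¹ * y + -√1) ⁻¹' Ioc r (r + ε) = Ioc (r + 1) (r + 1 + ε) := by
    ext y
    simp only [Real.sqrt_one, inv_one, one_mul, mem_preimage, mem_Ioc]
    constructor <;> rintro ⟨h1, h2⟩ <;> constructor <;> linarith
  rw [hpre, gammaMeasure_eq_withDensity_Ioi]
  refine withDensity_real_Ioc_le (p := gammaPDFReal 1 1) (fun x hx ↦ ?_) zero_le_one _ hε
  have hx' : (0 : ℝ) < x := hx
  rw [gammaPDFReal, if_pos hx'.le]
  simp [hx'.le]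

lemma ae_pos_withDensity_Ioi (p : ℝ → ENNReal) :
    ∀ᵐ x ∂((volume.restrict (Ioi (0 : ℝ))).withDensity p), 0 < x :=
  (withDensity_absolutelyContinuous _ _).ae_le (ae_restrict_mem measurableSet_Ioi)

lemma measureReal_Iic_of_neg {ν : Measure ℝ} (hν : ∀ᵐ x ∂ν, 0 < x) {x : ℝ} (hx : x < 0) :
    ν.real (Iic x) = 0 := by
  rw [measureReal_def, measure_mono_null (t := {y | ¬ 0 < y}) (fun y hy ↦ ?_) hν]
  · simp
  · have : y ≤ x := hy
    simp only [mem_ofPred_eq, not_lt]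
    linarith

lemma measureReal_Iic_of_nonneg {ν : Measure ℝ} (hν : ∀ᵐ x ∂ν, 0 < x) {x : ℝ} (hx : 0 ≤ x) :
    ν.real (Iic x) = ν.real {y | y ^ 2 ≤ x ^ 2} := by
  refine measureReal_congr ?_
  filter_upwards [hν] with y hy
  exact propext (pow_le_pow_iff_left₀ hy.le hx two_ne_zero).symm

/-- Distribution function of the Nakagami law in terms of the standardised gamma law. -/
lemma nakagamiMeasure_real_Iic {m Ωp x : ℝ} (hm : 0 < m) (hΩ : 0 < Ωp) (hx : 0 ≤ x) :
    (nakagamiMeasure m Ωp).real (Iic x) = (stdGamma m).real (Iic (√m * (x ^ 2 / Ωp - 1))) := by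
  have hs : 0 < √m := Real.sqrt_pos.2 hm
  have hpos : ∀ᵐ x ∂(nakagamiMeasure m Ωp), 0 < x := ae_pos_withDensity_Ioi _
  rw [stdGamma, ← map_nakagamiMeasure hm hΩ, Measure.map_map (by fun_prop) (by fun_prop),
    map_measureReal_apply (by fun_prop) measurableSet_Iic, measureReal_Iic_of_nonneg hpos hx]
  congr 1
  ext y
  have h1 : (√m)⁻¹ * (m * y ^ 2 / Ωp) + -√m = √m * (y ^ 2 / Ωp - 1) := by
    have : (√m)⁻¹ * m = √m := by
      rw [inv_mul_eq_iff_eq_mul₀ hs.ne', Real.mul_self_sqrt hm.le]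
    calc _ = ((√m)⁻¹ * m) * y ^ 2 / Ωp + -√m := by ring
      _ = _ := by rw [this]; ring
  simp only [mem_ofPred_eq, mem_preimage, Function.comp, mem_Iic, h1]
  rw [mul_le_mul_iff_right₀ hs, sub_le_sub_iff_right, div_le_div_iff_of_pos_right hΩ]

/-- The Rician law as the law of the modulus of a Gaussian displaced along the real axis. -/
lemma map_sqrt_mul_add_ricianMeasure {K Ωp : ℝ} (hK : 0 ≤ K) (hΩ : 0 < Ωp) :
    complexGaussian.map (fun z ↦ ‖(√(Ωp / (K + 1)) : ℂ) * z + (√(Ωp / (K + 1) * K) : ℝ)‖) =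
      ricianMeasure K Ωp ∧
    ∀ z : ℂ, ‖(√(Ωp / (K + 1)) : ℂ) * z + (√(Ωp / (K + 1) * K) : ℝ)‖ ^ 2 =
      Ωp / (K + 1) * (‖z‖ ^ 2 + 2 * √K * z.re + K) := by
  have hσ : 0 < Ωp / (K + 1) := by positivity
  set σ := Ωp / (K + 1) with hσd
  have hΩσ : Ωp = σ * (K + 1) := by rw [hσd]; field_simp
  have hb : ‖((√(σ * K) : ℝ) : ℂ)‖ ^ 2 = σ * K := by
    rw [Complex.norm_real, Real.norm_of_nonneg (Real.sqrt_nonneg _), Real.sq_sqrt (by positivity)]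
  constructor
  · have h := map_norm_sqrt_mul_add_complexGaussian hσ (√(σ * K) : ℝ)
    rw [hb, mul_div_cancel_left₀ _ hσ.ne', show σ * K + σ = Ωp by rw [hΩσ]; ring] at h
    exact h
  · intro z
    rw [Real.sqrt_mul hσ.le, Complex.ofReal_mul, ← mul_add, norm_mul, mul_pow, Complex.norm_real,
      Real.norm_of_nonneg (Real.sqrt_nonneg _), Real.sq_sqrt hσ.le, Complex.sq_norm,
      Complex.sq_norm, Complex.normSq_apply, Complex.normSq_apply]
    simp only [Complex.add_re, Complex.ofReal_re, Complex.add_im, Complex.ofReal_im, add_zero]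
    have := Real.sq_sqrt hK
    linear_combination σ * this

/-- Distribution function of the Rician law in terms of quadratic forms of a Gaussian. -/
lemma ricianMeasure_real_Iic {K Ωp x : ℝ} (hK : 0 ≤ K) (hΩ : 0 < Ωp) (hx : 0 ≤ x) :
    (ricianMeasure K Ωp).real (Iic x) =
      (quadFormLaw (2 * √K / √(2 * K + 1)) (√(2 * K + 1))⁻¹ : Measure ℝ).real
        (Iic ((K + 1) / √(2 * K + 1) * (x ^ 2 / Ωp - 1))) := by
  have hpos : ∀ᵐ x ∂(ricianMeasure K Ωp), 0 < x := ae_pos_withDensity_Ioi _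
  have hs : 0 < √(2 * K + 1) := Real.sqrt_pos.2 (by positivity)
  obtain ⟨h, hn⟩ := map_sqrt_mul_add_ricianMeasure hK hΩ
  rw [measureReal_Iic_of_nonneg hpos hx, ← h, map_measureReal_apply (by fun_prop)
    (measurableSet_le (by fun_prop) measurable_const)]
  change _ = (complexGaussian.map (quadForm _ _)).real _
  rw [map_measureReal_apply (continuous_quadForm _ _).measurable measurableSet_Iic]
  congr 1
  ext z
  simp only [mem_preimage, mem_ofPred_eq, hn, mem_Iic, quadForm]
  have hσ : 0 < Ωp / (K + 1) := by positivity
  have h1 : 2 * √K / √(2 * K + 1) * z.re + (√(2 * K + 1))⁻¹ * (‖z‖ ^ 2 - 1) =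
      (√(2 * K + 1))⁻¹ * (‖z‖ ^ 2 + 2 * √K * z.re + K - (K + 1)) := by ring
  have h2 : (K + 1) / √(2 * K + 1) * (x ^ 2 / Ωp - 1) =
      (√(2 * K + 1))⁻¹ * (x ^ 2 / (Ωp / (K + 1)) - (K + 1)) := by field_simp
  rw [h1, h2, mul_le_mul_iff_right₀ (inv_pos.2 hs), sub_le_sub_iff_right, le_div_iff₀ hσ, mul_comm]

/-- The Nakagami shape of a Rician law with shape factor `K`. -/
noncomputable def shapeOf (K : ℝ) : ℝ := (K + 1) ^ 2 / (2 * K + 1)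

lemma shapeOf_pos {K : ℝ} (hK : 0 ≤ K) : 0 < shapeOf K := by unfold shapeOf; positivity

lemma sqrt_shapeOf {K : ℝ} (hK : 0 ≤ K) : √(shapeOf K) = (K + 1) / √(2 * K + 1) := by
  rw [shapeOf, Real.sqrt_div (by positivity), Real.sqrt_sq (by positivity)]

/-- The distribution functions of a quadratic form and of the standardised gamma law are close as
soon as both laws have the same limit with bounded density. -/
lemma eventually_abs_quadFormLaw_sub_stdGamma_le {α β m : ℕ → ℝ} {a b : ℝ}
    (hm0 : ∀ k, 0 < m k) (hα : Tendsto α atTop (𝓝 a)) (hβ : Tendsto β atTop (𝓝 b))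
    (hm : ∀ ξ, Tendsto (fun k ↦ charFun (stdGamma (m k)) ξ) atTop
      (𝓝 (charFun (quadFormLaw a b : Measure ℝ) ξ)))
    (hb : ∀ r ε : ℝ, 0 ≤ ε → (quadFormLaw a b : Measure ℝ).real (Ioc r (r + ε)) ≤ 1 * ε)
    {η : ℝ} (hη : 0 < η) :
    ∀ᶠ k in atTop, ∀ y : ℝ, |(quadFormLaw (α k) (β k) : Measure ℝ).real (Iic y) -
      (stdGamma (m k)).real (Iic y)| ≤ η := by
  let ν : ℕ → ProbabilityMeasure ℝ := fun k ↦ ⟨_, isProbabilityMeasure_stdGamma (hm0 k)⟩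
  have hν : Tendsto ν atTop (𝓝 (quadFormLaw a b)) :=
    ProbabilityMeasure.tendsto_of_tendsto_charFun hm
  have hlip : ∀ f ∈ ({id} : Set (ℝ → ℝ)), LipschitzWith 1 f := by
    rintro _ rfl; exact LipschitzWith.id
  have hb' : ∀ f ∈ ({id} : Set (ℝ → ℝ)), ∀ r ε : ℝ, 0 ≤ ε →
      (quadFormLaw a b : Measure ℝ).real {x | f x ∈ Ioc r (r + ε)} ≤ 1 * ε := by
    rintro _ rfl r ε hε; exact hb r ε hε
  filter_upwards [eventually_forall_abs_sub_sublevel_le (tendsto_quadFormLaw hα hβ) hlip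
    zero_le_one hb' (half_pos hη), eventually_forall_abs_sub_sublevel_le hν hlip
    zero_le_one hb' (half_pos hη)] with k h1 h2 y
  have h1' := h1 id rfl y
  have h2' := h2 id rfl y
  have h2'' : |(stdGamma (m k)).real (Iic y) - (quadFormLaw a b : Measure ℝ).real (Iic y)| ≤ η / 2 :=
    h2'
  have h1'' : |(quadFormLaw (α k) (β k) : Measure ℝ).real (Iic y) -
      (quadFormLaw a b : Measure ℝ).real (Iic y)| ≤ η / 2 := h1'
  rw [abs_sub_comm] at h2''
  calc _ ≤ _ := abs_sub_le _ ((quadFormLaw a b : Measure ℝ).real (Iic y)) _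
    _ ≤ η / 2 + η / 2 := add_le_add h1'' h2''
    _ = η := by ring

/-- `K` is such that the standardised Rician and Nakagami laws differ by more than `η`. -/
def BadShape (η K : ℝ) : Prop :=
  0 ≤ K ∧ ∃ y : ℝ, η < |(quadFormLaw (2 * √K / √(2 * K + 1)) (√(2 * K + 1))⁻¹ : Measure ℝ).real
    (Iic y) - (stdGamma (shapeOf K)).real (Iic y)|

lemma exists_forall_not_badShape_small {η : ℝ} (hη : 0 < η) :
    ∃ L : ℝ, 0 < L ∧ ∀ K, K ≤ L⁻¹ → ¬ BadShape η K := by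
  by_contra! hcon
  choose K hK hbad using fun k : ℕ ↦ hcon ((k : ℝ) + 1) (by positivity)
  have hK0 : Tendsto K atTop (𝓝 0) := by
    refine squeeze_zero (fun k ↦ (hbad k).1) (fun k ↦ ?_) tendsto_one_div_add_atTop_nhds_zero_nat
    rw [one_div]; exact hK k
  have hc1 : ContinuousAt (fun K : ℝ ↦ 2 * √K / √(2 * K + 1)) 0 :=
    ContinuousAt.div (by fun_prop) (by fun_prop) (by simp)
  have hc2 : ContinuousAt (fun K : ℝ ↦ (√(2 * K + 1))⁻¹) 0 :=
    ContinuousAt.inv₀ (by fun_prop) (by simp)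
  have hc3 : ContinuousAt shapeOf 0 := by
    unfold shapeOf
    exact ContinuousAt.div (by fun_prop) (by fun_prop) (by simp)
  have h1 := hc1.tendsto.comp hK0
  have h2 := hc2.tendsto.comp hK0
  have h3 := hc3.tendsto.comp hK0
  simp only [Real.sqrt_zero, mul_zero, zero_div, zero_add, Real.sqrt_one, inv_one] at h1 h2
  have h3' : Tendsto (fun k ↦ shapeOf (K k)) atTop (𝓝 1) := by
    have h0 : shapeOf 0 = 1 := by simp [shapeOf]
    rwa [h0] at h3
  have h := eventually_abs_quadFormLaw_sub_stdGamma_le (m := fun k ↦ shapeOf (K k))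
    (fun k ↦ shapeOf_pos (hbad k).1) h1 h2
    (fun ξ ↦ by
      rw [quadFormLaw_zero_one]
      exact tendsto_charFun_stdGamma_one h3' (fun k ↦ shapeOf_pos (hbad k).1) ξ)
    (fun r ε hε ↦ by rw [quadFormLaw_zero_one]; exact stdGamma_one_real_Ioc_le r hε) hη
  obtain ⟨k, hk⟩ := h.exists
  obtain ⟨y, hy⟩ := (hbad k).2
  exact absurd (hk y) (not_le.2 hy)

lemma exists_forall_not_badShape_large {η : ℝ} (hη : 0 < η) :
    ∃ L : ℝ, 0 < L ∧ ∀ K, L ≤ K → ¬ BadShape η K := by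
  by_contra! hcon
  choose K hK hbad using fun k : ℕ ↦ hcon ((k : ℝ) + 1) (by positivity)
  have hK0 : Tendsto K atTop atTop :=
    tendsto_atTop_mono (fun k ↦ (le_add_of_nonneg_right zero_le_one).trans (hK k))
      tendsto_natCast_atTop_atTop
  have hKpos : ∀ k, 0 < K k := fun k ↦ lt_of_lt_of_le (by positivity) (hK k)
  have h2K : Tendsto (fun k ↦ 2 * K k + 1) atTop atTop :=
    tendsto_atTop_add_const_right _ _ (hK0.const_mul_atTop two_pos)
  have h2 : Tendsto (fun k ↦ (√(2 * K k + 1))⁻¹) atTop (𝓝 0) :=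
    (Real.tendsto_sqrt_atTop.comp h2K).inv_tendsto_atTop
  have h1 : Tendsto (fun k ↦ 2 * √(K k) / √(2 * K k + 1)) atTop (𝓝 (√2)) := by
    have h : Tendsto (fun k ↦ √(2 - 2 * (2 * K k + 1)⁻¹)) atTop (𝓝 (√(2 - 2 * 0))) :=
      (Real.continuous_sqrt.tendsto _).comp (tendsto_const_nhds.sub
        (h2K.inv_tendsto_atTop.const_mul 2))
    rw [mul_zero, sub_zero] at h
    refine h.congr fun k ↦ ?_
    have := hKpos k
    rw [show (2 : ℝ) - 2 * (2 * K k + 1)⁻¹ = 2 ^ 2 * K k / (2 * K k + 1) by field_simp; ring,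
      Real.sqrt_div (by positivity), Real.sqrt_mul (by positivity), Real.sqrt_sq zero_le_two]
  have h3 : Tendsto (fun k ↦ shapeOf (K k)) atTop atTop := by
    refine tendsto_atTop_mono (fun k ↦ ?_) (hK0.atTop_div_const two_pos)
    have := hKpos k
    rw [shapeOf, div_le_div_iff₀ two_pos (by positivity)]
    nlinarith
  have h := eventually_abs_quadFormLaw_sub_stdGamma_le (m := fun k ↦ shapeOf (K k))
    (fun k ↦ shapeOf_pos (hbad k).1) h1 h2
    (fun ξ ↦ by
      rw [quadFormLaw_sqrt_two_zero]
      exact tendsto_charFun_stdGamma_atTop h3 (fun k ↦ shapeOf_pos (hbad k).1) ξ)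
    (fun r ε hε ↦ by rw [quadFormLaw_sqrt_two_zero]; exact gaussianReal_real_Ioc_le r hε) hη
  obtain ⟨k, hk⟩ := h.exists
  obtain ⟨y, hy⟩ := (hbad k).2
  exact absurd (hk y) (not_le.2 hy)

/-- The Rician law with small or large shape factor is close to the Nakagami law with the same
second and fourth moments. -/
lemma exists_forall_abs_rician_sub_nakagami_le {η : ℝ} (hη : 0 < η) :
    ∃ L : ℝ, 0 < L ∧ ∀ K Ωp : ℝ, 0 ≤ K → 0 < Ωp → K ≤ L⁻¹ ∨ L ≤ K → ∀ x : ℝ,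
      |(ricianMeasure K Ωp).real (Iic x) - (nakagamiMeasure (shapeOf K) Ωp).real (Iic x)| ≤ η := by
  obtain ⟨L₁, hL₁, h₁⟩ := exists_forall_not_badShape_small hη
  obtain ⟨L₂, hL₂, h₂⟩ := exists_forall_not_badShape_large hη
  refine ⟨max L₁ L₂, lt_max_of_lt_left hL₁, fun K Ωp hK hΩ hor x ↦ ?_⟩
  have hgood : ¬ BadShape η K := by
    rcases hor with h | h
    · exact h₁ K (h.trans (inv_anti₀ hL₁ (le_max_left _ _)))
    · exact h₂ K ((le_max_right _ _).trans h)
  rcases lt_or_ge x 0 with hx | hx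
  · rw [measureReal_Iic_of_neg (ν := ricianMeasure K Ωp) (ae_pos_withDensity_Ioi _) hx,
      measureReal_Iic_of_neg (ν := nakagamiMeasure (shapeOf K) Ωp) (ae_pos_withDensity_Ioi _) hx]
    simpa using hη.le
  · rw [ricianMeasure_real_Iic hK hΩ hx, nakagamiMeasure_real_Iic (shapeOf_pos hK) hΩ hx,
      sqrt_shapeOf hK]
    by_contra! hlt
    exact hgood ⟨hK, _, hlt⟩

lemma integral_id_gammaMeasure {m : ℝ} (hm : 0 < m) : ∫ x, x ∂(gammaMeasure m 1) = m := by
  have hG := Real.Gamma_pos_of_pos hm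
  have h := Real.Gamma_eq_integral (s := m + 1) (by positivity)
  rw [Real.Gamma_add_one hm.ne', add_sub_cancel_right] at h
  rw [integral_gammaMeasure hm]
  have h1 : ∀ x ∈ Ioi (0 : ℝ), (Real.Gamma m)⁻¹ * (x ^ (m - 1) * Real.exp (-x)) * x =
      (Real.Gamma m)⁻¹ * (Real.exp (-x) * x ^ m) := fun x hx ↦ by
    have hx' : (0 : ℝ) < x := hx
    rw [Real.rpow_sub_one hx'.ne']
    field_simp
  rw [setIntegral_congr_fun measurableSet_Ioi h1, integral_const_mul, ← h]
  field_simp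

lemma integral_sq_gammaMeasure {m : ℝ} (hm : 0 < m) :
    ∫ x, x ^ 2 ∂(gammaMeasure m 1) = m * (m + 1) := by
  have hG := Real.Gamma_pos_of_pos hm
  have h := Real.Gamma_eq_integral (s := m + 1 + 1) (by positivity)
  rw [Real.Gamma_add_one (by positivity), Real.Gamma_add_one hm.ne', add_sub_cancel_right] at h
  rw [integral_gammaMeasure hm]
  have h1 : ∀ x ∈ Ioi (0 : ℝ), (Real.Gamma m)⁻¹ * (x ^ (m - 1) * Real.exp (-x)) * x ^ 2 =
      (Real.Gamma m)⁻¹ * (Real.exp (-x) * x ^ (m + 1)) := fun x hx ↦ by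
    have hx' : (0 : ℝ) < x := hx
    rw [Real.rpow_sub_one hx'.ne', Real.rpow_add_one hx'.ne']
    field_simp
  rw [setIntegral_congr_fun measurableSet_Ioi h1, integral_const_mul, ← h]
  field_simp

lemma integral_sq_nakagamiMeasure {m Ωp : ℝ} (hm : 0 < m) (hΩ : 0 < Ωp) :
    ∫ x, x ^ 2 ∂(nakagamiMeasure m Ωp) = Ωp := by
  have h := integral_id_gammaMeasure hm
  rw [← map_nakagamiMeasure hm hΩ, integral_map (by fun_prop) (by fun_prop)] at h
  have h1 : ∀ x : ℝ, m * x ^ 2 / Ωp = m / Ωp * x ^ 2 := fun x ↦ by ring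
  simp_rw [h1] at h
  rw [integral_const_mul] at h
  field_simp at h
  exact h

lemma integral_pow_four_nakagamiMeasure {m Ωp : ℝ} (hm : 0 < m) (hΩ : 0 < Ωp) :
    ∫ x, x ^ 4 ∂(nakagamiMeasure m Ωp) = Ωp ^ 2 * (1 + m⁻¹) := by
  have h := integral_sq_gammaMeasure hm
  rw [← map_nakagamiMeasure hm hΩ, integral_map (by fun_prop) (by fun_prop)] at h
  have h1 : ∀ x : ℝ, (m * x ^ 2 / Ωp) ^ 2 = (m / Ωp) ^ 2 * x ^ 4 := fun x ↦ by ring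
  simp_rw [h1] at h
  rw [integral_const_mul] at h
  field_simp at h ⊢
  linarith

lemma integrable_pow_gammaMeasure {m : ℝ} (hm : 0 < m) (n : ℕ) :
    Integrable (fun x ↦ x ^ n) (gammaMeasure m 1) := by
  have h0 : (0 : ℝ) ∈ interior (integrableExpSet id (gammaMeasure m 1)) :=
    interior_maximal (fun t ht ↦ integrable_exp_gammaMeasure hm ht) isOpen_Iio (mem_Iio.2 one_pos)
  exact integrable_pow_of_mem_interior_integrableExpSet h0 n

lemma integrable_sq_norm_pow_complexGaussian (n : ℕ) :
    Integrable (fun z : ℂ ↦ (‖z‖ ^ 2) ^ n) complexGaussian := by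
  have h := integrable_pow_gammaMeasure one_pos n
  rw [← map_sq_norm_complexGaussian, integrable_map_measure (by fun_prop) (by fun_prop)] at h
  exact h

lemma integral_sq_norm_complexGaussian : ∫ z, ‖z‖ ^ 2 ∂complexGaussian = 1 := by
  have h := integral_id_gammaMeasure one_pos
  rwa [← map_sq_norm_complexGaussian, integral_map (by fun_prop) (by fun_prop)] at h

lemma integral_pow_four_norm_complexGaussian : ∫ z, (‖z‖ ^ 2) ^ 2 ∂complexGaussian = 2 := by
  have h := integral_sq_gammaMeasure one_pos
  rw [← map_sq_norm_complexGaussian, integral_map (by fun_prop) (by fun_prop)] at h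
  rw [h]; norm_num

lemma integral_sq_re_complexGaussian : ∫ z, z.re ^ 2 ∂complexGaussian = 1 / 2 := by
  have hv : ∫ x, x ^ 2 ∂(gaussianReal 0 1) = 1 := by
    have h := variance_of_integral_eq_zero (X := id) (μ := gaussianReal 0 1) (by fun_prop)
      (by simp [integral_id_gaussianReal])
    rw [variance_id_gaussianReal] at h
    simpa using h.symm
  rw [← quadFormLaw_sqrt_two_zero] at hv
  change ∫ x, x ^ 2 ∂(complexGaussian.map (quadForm (√2) 0)) = 1 at hv
  rw [integral_map (continuous_quadForm _ _).aemeasurable (by fun_prop)] at hv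
  have h1 : ∀ z : ℂ, quadForm (√2) 0 z ^ 2 = 2 * z.re ^ 2 := fun z ↦ by
    rw [quadForm, zero_mul, add_zero, mul_pow, Real.sq_sqrt zero_le_two]
  simp_rw [h1] at hv
  rw [integral_const_mul] at hv
  linarith

lemma map_neg_complexGaussian : complexGaussian.map (fun z ↦ (-1 : ℝ) • z) = complexGaussian := by
  have : IsProbabilityMeasure (complexGaussian.map (fun z ↦ (-1 : ℝ) • z)) :=
    Measure.isProbabilityMeasure_map (by fun_prop)
  refine Measure.ext_of_charFun ?_
  ext ξ
  rw [charFun_map_smul, charFun_complexGaussian, charFun_complexGaussian]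
  simp

lemma integral_eq_zero_of_odd {f : ℂ → ℝ} (hf : Measurable f) (hodd : ∀ z, f (-z) = -f z) :
    ∫ z, f z ∂complexGaussian = 0 := by
  have h : ∫ z, f z ∂complexGaussian = -∫ z, f z ∂complexGaussian := by
    conv_lhs => rw [← map_neg_complexGaussian]
    rw [integral_map (by fun_prop) hf.aestronglyMeasurable, ← integral_neg]
    congr 1
    ext z
    rw [neg_one_smul, hodd]
  linarith

lemma integrable_of_le_one_add_pow_four {f : ℂ → ℝ} (hf : Measurable f) {C : ℝ}
    (h : ∀ z, |f z| ≤ C * (1 + (‖z‖ ^ 2) ^ 2)) : Integrable f complexGaussian := by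
  refine (((integrable_const 1).add (integrable_sq_norm_pow_complexGaussian 2)).const_mul C).mono'
    hf.aestronglyMeasurable (Eventually.of_forall fun z ↦ ?_)
  simpa using h z

/-- Second and fourth moments of a Gaussian displaced along the real axis. -/
lemma integral_displaced_complexGaussian (K k : ℝ) :
    ∫ z : ℂ, (‖z‖ ^ 2 + 2 * k * z.re + K) ∂complexGaussian = 1 + K ∧
    ∫ z : ℂ, (‖z‖ ^ 2 + 2 * k * z.re + K) ^ 2 ∂complexGaussian =
      2 + 2 * k ^ 2 + K ^ 2 + 2 * K := by
  have hre : ∀ z : ℂ, |z.re| ≤ ‖z‖ := Complex.abs_re_le_norm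
  have hi1 : Integrable (fun z : ℂ ↦ z.re) complexGaussian :=
    integrable_of_le_one_add_pow_four (C := 1) (by fun_prop) fun z ↦ by
      have := hre z
      nlinarith [sq_nonneg (‖z‖ - 1), sq_nonneg (‖z‖ ^ 2 - 1 / 2), norm_nonneg z]
  have hi2 : Integrable (fun z : ℂ ↦ ‖z‖ ^ 2) complexGaussian := by
    simpa using integrable_sq_norm_pow_complexGaussian 1
  have hi3 : Integrable (fun z : ℂ ↦ z.re ^ 2) complexGaussian :=
    hi2.mono' (by fun_prop) (Eventually.of_forall fun z ↦ by
      rw [Real.norm_of_nonneg (by positivity), ← sq_abs]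
      gcongr
      exact hre z)
  have hi4 := integrable_sq_norm_pow_complexGaussian 2
  have hi5 : Integrable (fun z : ℂ ↦ ‖z‖ ^ 2 * z.re) complexGaussian :=
    integrable_of_le_one_add_pow_four (C := 1) (by fun_prop) fun z ↦ by
      rw [abs_mul, abs_of_nonneg (by positivity)]
      have h1 : ‖z‖ ^ 2 * |z.re| ≤ ‖z‖ ^ 2 * ‖z‖ := by gcongr; exact hre z
      nlinarith [sq_nonneg (‖z‖ ^ 2 - ‖z‖), sq_nonneg (‖z‖ ^ 2 - 1 / 2), norm_nonneg z,
        sq_nonneg (‖z‖ - 1), sq_nonneg (‖z‖ ^ 2)]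
  have ho1 : ∫ z : ℂ, z.re ∂complexGaussian = 0 :=
    integral_eq_zero_of_odd (by fun_prop) fun z ↦ by simp
  have ho2 : ∫ z : ℂ, ‖z‖ ^ 2 * z.re ∂complexGaussian = 0 :=
    integral_eq_zero_of_odd (by fun_prop) fun z ↦ by simp
  constructor
  · have ha : Integrable (fun z : ℂ ↦ ‖z‖ ^ 2 + 2 * k * z.re) complexGaussian :=
      hi2.add (hi1.const_mul _)
    rw [integral_add ha (integrable_const _), integral_add hi2 (hi1.const_mul _),
      integral_const_mul, ho1, integral_sq_norm_complexGaussian]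
    simp
  · have hexp : ∀ z : ℂ, (‖z‖ ^ 2 + 2 * k * z.re + K) ^ 2 =
        (‖z‖ ^ 2) ^ 2 + 4 * k ^ 2 * z.re ^ 2 + 2 * K * ‖z‖ ^ 2 + 4 * k * (‖z‖ ^ 2 * z.re) +
          4 * k * K * z.re + K ^ 2 := fun z ↦ by ring
    simp_rw [hexp]
    have ha : Integrable (fun z : ℂ ↦ (‖z‖ ^ 2) ^ 2 + 4 * k ^ 2 * z.re ^ 2) complexGaussian :=
      hi4.add (hi3.const_mul _)
    have hb : Integrable (fun z : ℂ ↦ (‖z‖ ^ 2) ^ 2 + 4 * k ^ 2 * z.re ^ 2 + 2 * K * ‖z‖ ^ 2)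
        complexGaussian := ha.add (hi2.const_mul _)
    have hc : Integrable (fun z : ℂ ↦ (‖z‖ ^ 2) ^ 2 + 4 * k ^ 2 * z.re ^ 2 + 2 * K * ‖z‖ ^ 2 +
        4 * k * (‖z‖ ^ 2 * z.re)) complexGaussian := hb.add (hi5.const_mul _)
    have hd : Integrable (fun z : ℂ ↦ (‖z‖ ^ 2) ^ 2 + 4 * k ^ 2 * z.re ^ 2 + 2 * K * ‖z‖ ^ 2 +
        4 * k * (‖z‖ ^ 2 * z.re) + 4 * k * K * z.re) complexGaussian := hc.add (hi1.const_mul _)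
    rw [integral_add hd (integrable_const _), integral_add hc (hi1.const_mul _),
      integral_add hb (hi5.const_mul _), integral_add ha (hi2.const_mul _),
      integral_add hi4 (hi3.const_mul _)]
    simp only [integral_const_mul, ho1, ho2, integral_sq_norm_complexGaussian,
      integral_pow_four_norm_complexGaussian, integral_sq_re_complexGaussian]
    simp
    ring

lemma integral_ricianMeasure {K Ωp : ℝ} (hK : 0 ≤ K) (hΩ : 0 < Ωp) :
    ∫ x, x ^ 2 ∂(ricianMeasure K Ωp) = Ωp ∧
    ∫ x, x ^ 4 ∂(ricianMeasure K Ωp) = Ωp ^ 2 * (1 + (shapeOf K)⁻¹) := by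
  have hσ : 0 < Ωp / (K + 1) := by positivity
  set σ := Ωp / (K + 1) with hσd
  have hΩσ : Ωp = σ * (K + 1) := by rw [hσd]; field_simp
  have h := map_sqrt_mul_add_ricianMeasure hK hΩ
  obtain ⟨h2, h4⟩ := integral_displaced_complexGaussian K (√K)
  have hpow : ∀ x : ℝ, x ^ 4 = (x ^ 2) ^ 2 := fun x ↦ by ring
  simp_rw [hpow]
  rw [← h.1, integral_map (by fun_prop) (by fun_prop), integral_map (by fun_prop) (by fun_prop)]
  simp_rw [h.2, mul_pow]
  rw [integral_const_mul, integral_const_mul, h2, h4, Real.sq_sqrt hK, ← hσd, hΩσ, shapeOf]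
  constructor
  · ring
  · field_simp
    ring

section Model

variable {S : Type*} [MeasurableSpace S] {μ : Measure S} {X : Randomness S}
  {g : Config} {t : ℝ} {M N : ℕ}

lemma KEff_nonneg (h : Balanced X μ g t M N) : 0 ≤ KEff X μ g t M N :=
  div_nonneg (by unfold XiSq; positivity) h.1.le

lemma scale_pos (h : Balanced X μ g t M N) : 0 < scale X μ g t M N :=
  add_pos_of_nonneg_of_pos (by unfold XiSq; positivity) h.1

lemma mNak_eq (h : Balanced X μ g t M N) : mNak X μ g t M N = shapeOf (KEff X μ g t M N) := by
  have hΞ : 0 ≤ XiSq X μ g t M N := by unfold XiSq; positivity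
  have hσ := h.1
  rw [mNak, KEff, shapeOf]
  generalize XiSq X μ g t M N = x at *
  generalize sigma X μ g t M N = σ at *
  have h1 : (σ + x) ^ 2 - x ^ 2 = σ * (2 * x + σ) := by ring
  rw [h1]
  field_simp
  ring

lemma Randomness.IsIID.integral_sq_norm_complexEnvelope [IsProbabilityMeasure μ]
    (hX : X.IsIID μ) (g : Config) (t : ℝ) (M N : ℕ) :
    ∫ s, ‖complexEnvelope X g t M N s‖ ^ 2 ∂μ = scale X μ g t M N := by
  have hc := hX.memLp_Tc g t M N
  have hs := hX.memLp_Ts g t M N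
  have h1 : ∀ s, ‖complexEnvelope X g t M N s‖ ^ 2 =
      Tc X g t M N s ^ 2 + Ts X g t M N s ^ 2 := fun s ↦ by
    rw [Complex.sq_norm, Complex.normSq_apply, complexEnvelope_re, complexEnvelope_im]
    ring
  simp_rw [h1]
  rw [integral_add hc.integrable_sq hs.integrable_sq, scale, XiSq, sigma, variance_eq_sub hc,
    variance_eq_sub hs]
  simp only [Pi.pow_apply]
  ring

/-- Nakagami approximation of the envelope for small or large effective shape factor, together with
the Rician one. -/
lemma Randomness.IsIID.exists_forall_envelopeWithin [IsProbabilityMeasure μ]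
    (hX : X.IsIID μ) (t : ℝ) {η : ℝ} (hη : 0 < η) :
    ∃ n₀ : ℕ, ∃ L : ℝ, 0 < L ∧ ∀ M N : ℕ, n₀ ≤ M → n₀ ≤ N →
      ∀ g : Config, Balanced X μ g t M N →
        EnvelopeWithin X μ g t M N (ricianMeasure (KEff X μ g t M N) (scale X μ g t M N)) η ∧
        (KEff X μ g t M N ≤ L⁻¹ ∨ L ≤ KEff X μ g t M N →
          EnvelopeWithin X μ g t M N
            (nakagamiMeasure (mNak X μ g t M N) (scale X μ g t M N)) η) := by
  obtain ⟨n₀, hn₀⟩ := hX.exists_forall_envelopeWithin_rician t (half_pos hη)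
  obtain ⟨L, hL, h⟩ := exists_forall_abs_rician_sub_nakagami_le (half_pos hη)
  refine ⟨n₀, L, hL, fun M N hM hN g hB ↦ ⟨fun x ↦ (hn₀ M N hM hN g hB x).trans (half_le_self hη.le),
    fun hor x ↦ ?_⟩⟩
  rw [mNak_eq hB]
  calc _ ≤ _ := abs_sub_le _
        ((ricianMeasure (KEff X μ g t M N) (scale X μ g t M N)).real (Iic x)) _
    _ ≤ η / 2 + η / 2 := add_le_add (hn₀ M N hM hN g hB x)
        (h _ _ (KEff_nonneg hB) (scale_pos hB) hor x)
    _ = η := by ring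

/-- With aligned nominal phases the effective shape factor is proportional to the number of
components. -/
lemma Randomness.IsIID.exists_KEff_eq_mul [IsProbabilityMeasure μ] (hX : X.IsIID μ)
    (hg : ∀ m : ℕ, g.φ m = g.ε * (m + 1)) (t : ℝ) :
    ∃ κ : ℝ, 0 ≤ κ ∧ ∀ M : ℕ, KEff X μ g t M M = M * κ := by
  have hrot : ∀ m, risRotation g t m = risRotation g t 0 := fun m ↦ by
    simp only [risRotation, hg, sub_add_cancel]
  set a := risRotation g t 0 * ∫ s, risPhasor X 0 s ∂μ + ∫ s, directPhasor X t 0 s ∂μ with ha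
  set v := cvar μ (risPhasor X 0) + cvar μ (directPhasor X t 0) with hv
  have hv0 : 0 ≤ v := add_nonneg cvar_nonneg cvar_nonneg
  refine ⟨‖a‖ ^ 2 / v, by positivity, fun M ↦ ?_⟩
  have hLr := fun m ↦ (hX.identDistrib_risPhasor m).symm.memLp_snd hX.memLp_risPhasor
  have hLd := fun m ↦ (hX.identDistrib_directPhasor t m).symm.memLp_snd (hX.memLp_directPhasor t)
  have hmean : ∫ s, complexEnvelope X g t M M s ∂μ = M * a := by
    simp_rw [complexEnvelope_eq]
    rw [integral_add ((memLp_rotSum hLr M).integrable (by norm_num))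
      ((memLp_rotSum hLd M).integrable (by norm_num)),
      integral_rotSum hX.identDistrib_risPhasor hX.memLp_risPhasor,
      integral_rotSum (hX.identDistrib_directPhasor t) (hX.memLp_directPhasor t)]
    simp_rw [hrot]
    simp [ha]
    ring
  rw [KEff, hX.XiSq_eq, hX.sigma_eq, hmean, norm_mul, Complex.norm_natCast, ← mul_add, ← hv]
  rcases eq_or_ne (M : ℝ) 0 with h | h
  · rw [h]; simp
  · rw [mul_pow, sq (M : ℝ), mul_assoc, mul_div_mul_left _ _ h, mul_div_assoc]

end Model

end RIS

theorem theorem2 {S : Type*} [MeasurableSpace S] (μ : Measure S) [IsProbabilityMeasure μ]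
    (X : RIS.Randomness S) (hX : X.IsIID μ) (t : ℝ) :
    -- Rician approximation, and Nakagami approximation for small or large effective shape factor,
    -- uniformly in the deterministic parameters
    (∀ η : ℝ, 0 < η → ∃ n₀ : ℕ, ∃ L : ℝ, 0 < L ∧ ∀ M N : ℕ, n₀ ≤ M → n₀ ≤ N →
      ∀ g : RIS.Config, RIS.Balanced X μ g t M N →
        RIS.EnvelopeWithin X μ g t M N
          (RIS.ricianMeasure (RIS.KEff X μ g t M N) (RIS.scale X μ g t M N)) η ∧
        (RIS.KEff X μ g t M N ≤ L⁻¹ ∨ L ≤ RIS.KEff X μ g t M N →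
          RIS.EnvelopeWithin X μ g t M N
            (RIS.nakagamiMeasure (RIS.mNak X μ g t M N) (RIS.scale X μ g t M N)) η)) ∧
    -- Nakagami approximation for as many multipath components as columns, when the terms of the RIS
    -- link are identically distributed because the nominal phase shifts are aligned
    (∀ g : RIS.Config, (∀ m : ℕ, g.φ m = g.ε * (m + 1)) →
      ∀ η : ℝ, 0 < η → ∃ n₀ : ℕ, ∀ M : ℕ, n₀ ≤ M → RIS.Balanced X μ g t M M →
        RIS.EnvelopeWithin X μ g t M M
          (RIS.nakagamiMeasure (RIS.mNak X μ g t M M) (RIS.scale X μ g t M M)) η) ∧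
    -- for all numbers of components, the scale factor is the mean square of the envelope, and the
    -- Nakagami law is the one equivalent to the Rician law: equal second and fourth moments
    (∀ (M N : ℕ) (g : RIS.Config), RIS.Balanced X μ g t M N →
      ∫ s, ‖RIS.complexEnvelope X g t M N s‖ ^ 2 ∂μ = RIS.scale X μ g t M N ∧
      0 < RIS.mNak X μ g t M N ∧
      ∀ m' Ω' : ℝ, 0 < m' → 0 < Ω' →
        ((∫ x, x ^ 2 ∂(RIS.nakagamiMeasure m' Ω') =
            ∫ x, x ^ 2 ∂(RIS.ricianMeasure (RIS.KEff X μ g t M N) (RIS.scale X μ g t M N)) ∧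
          ∫ x, x ^ 4 ∂(RIS.nakagamiMeasure m' Ω') =
            ∫ x, x ^ 4 ∂(RIS.ricianMeasure (RIS.KEff X μ g t M N) (RIS.scale X μ g t M N))) ↔
          m' = RIS.mNak X μ g t M N ∧ Ω' = RIS.scale X μ g t M N)) := by
  refine ⟨fun η hη ↦ hX.exists_forall_envelopeWithin t hη, fun g hg η hη ↦ ?_,
    fun M N g hB ↦ ⟨hX.integral_sq_norm_complexEnvelope g t M N, ?_, fun m' Ω' hm' hΩ' ↦ ?_⟩⟩
  · obtain ⟨n₀, L, hL, h⟩ := hX.exists_forall_envelopeWithin t hη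
    obtain ⟨κ, hκ, hK⟩ := hX.exists_KEff_eq_mul hg t
    rcases hκ.eq_or_lt with h0 | h0
    · refine ⟨n₀, fun M hM hB ↦ (h M M hM hM g hB).2 (Or.inl ?_)⟩
      rw [hK, ← h0, mul_zero]
      positivity
    · refine ⟨max n₀ ⌈L / κ⌉₊, fun M hM hB ↦ ?_⟩
      have hM' := (le_max_left _ _).trans hM
      refine (h M M hM' hM' g hB).2 (Or.inr ?_)
      rw [hK, ← div_le_iff₀ h0]
      exact Nat.ceil_le.1 ((le_max_right _ _).trans hM)
  · rw [RIS.mNak_eq hB]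
    exact RIS.shapeOf_pos (RIS.KEff_nonneg hB)
  · have hm0 := RIS.shapeOf_pos (RIS.KEff_nonneg hB)
    have hΩ0 := RIS.scale_pos hB
    obtain ⟨h2, h4⟩ := RIS.integral_ricianMeasure (RIS.KEff_nonneg hB) hΩ0
    rw [h2, h4, RIS.integral_sq_nakagamiMeasure hm' hΩ',
      RIS.integral_pow_four_nakagamiMeasure hm' hΩ', RIS.mNak_eq hB]
    constructor
    · rintro ⟨rfl, h⟩
      have h' := mul_left_cancel₀ (pow_pos hΩ' 2).ne' h
      exact ⟨inv_injective (add_left_cancel h'), rfl⟩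
    · rintro ⟨rfl, rfl⟩
      exact ⟨rfl, rfl⟩
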